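/- All graphs are finite and may have loops and multiple edges. A finite digraph ${\vec G}$ (with underlying graph $G$ and edge set $E$) is \emph{bipolar} with respect to $p\in E$ if it is acyclic and has a unique source and a unique sink, which are the extremities of $p$ (such a digraph is connected). For a spanning tree $T$ of $G$ and $b\in T$, the fundamental cocycle $C^*(T;b)=C^*_{\vec G}(T;b)$ is the set of edges joining the two components of $T\setminus\{b\}$, two of its edges having the same direction (sign) if they cross this vertex partition the same way, and opposite directions otherwise. For $e\in E\setminus T$, the fundamental cycle $C(T;e)=C_{\vec G}(T;e)$ is the unique cycle contained in $T\cup\{e\}$, two of its edges having the same direction if they are traversed consistently when running around the cycle, and opposite directions otherwise. If $E$ is linearly ordered and ${\vec G}$ is bipolar with respect to $\min(E)$, the \emph{fully optimal spanning tree} $\alpha({\vec G})$ is the unique spanning tree $T$ of $G$ such that (i) for every $b\in T\setminus\{\min(E)\}$, $b$ and $\min(C^*(T;b))$ have opposite directions in $C^*(T;b)$; (ii) for every $e\in E\setminus T$, $e$ and $\min(C(T;e))$ have opposite directions in $C(T;e)$. \textbf{Theorem.} Let ${\vec G}$ be a finite digraph on a linearly ordered set of edges $E$ which is bipolar with respect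 to $p=\min(E)$, and let $\omega=\max(E)$. Then there is exactly one spanning tree satisfying (i) and (ii), so that $\alpha({\vec G})$ is well defined, and it satisfies the following inductive definition. If $|E|=1$, then $\alpha({\vec G})=\{\omega\}$. If $|E|>1$, then at least one of ${\vec G}/\omega$, ${\vec G}\backslash\omega$ is bipolar with respect to $p$, and: 1. If ${\vec G}/\omega$ is bipolar with respect to $p$ but ${\vec G}\backslash\omega$ is not, then $\alpha({\vec G})=\alpha({\vec G}/\omega)\cup\{\omega\}$. 2. If ${\vec G}\backslash\omega$ is bipolar with respect to $p$ but ${\vec G}/\omega$ is not, then $\alpha({\vec G})=\alpha({\vec G}\backslash\omega)$. 3. If both ${\vec G}\backslash\omega$ and ${\vec G}/\omega$ are bipolar with respect to $p$, let $T'=\alpha({\vec G}\backslash\omega)$, $C=C_{\vec G}(T';\omega)$ and $e=\min(C)$. If $e$ and $\omega$ have opposite directions in $C$, then $\alpha({\vec G})=\alpha({\vec G}\backslash\omega)$; if they have the same direction in $C$, then $\alpha({\vec G})=\alpha({\vec G}/\omega)\cup\{\omega\}$. Equivalently, let $T''=\alpha({\vec G}/\omega)$, $D=C^*_{\vec G}(T''\cup\{\omega\};\omega)$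 and $f=\min(D)$. If $f$ and $\omega$ have opposite directions in $D$, then $\alpha({\vec G})=\alpha({\vec G}/\omega)\cup\{\omega\}$; if they have the same direction in $D$, then $\alpha({\vec G})=\alpha({\vec G}\backslash\omega)$. The two tests always agree: $e$ and $\omega$ have opposite directions in $C$ if and only if $f$ and $\omega$ have the same direction in $D$. -/

import Mathlib

/-- A signed edge subset `C = (C⁺, C⁻)`. -/
structure SignedSubset (β : Type*) where
  pos : Set β
  neg : Set β
  disjoint : Disjoint pos neg

namespace SignedSubset

variable {β : Type*}

/-- The underlying unsigned set. -/
def support (C : SignedSubset β) : Set β := C.pos ∪ C.neg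

/-- `a` and `b` both belong to `C` and have opposite signs (directions) in `C`. -/
def Opposite (C : SignedSubset β) (a b : β) : Prop :=
  (a ∈ C.pos ∧ b ∈ C.neg) ∨ (a ∈ C.neg ∧ b ∈ C.pos)

/-- `a` and `b` both belong to `C` and have the same sign (direction) in `C`. -/
def Same (C : SignedSubset β) (a b : β) : Prop :=
  (a ∈ C.pos ∧ b ∈ C.pos) ∨ (a ∈ C.neg ∧ b ∈ C.neg)

/-- The empty signed subset. -/
def empty : SignedSubset β := ⟨∅, ∅, disjoint_bot_left⟩

end SignedSubset

/-- A directed graph, loops and multiple edges allowed, with vertex set `V` (the whole type) and a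
finite edge set `edges` of elements of `β`. The values of `tail` and `head` outside `edges` play no
role. -/
structure MultiDigraph (V β : Type*) where
  edges : Finset β
  tail : β → V
  head : β → V

namespace MultiDigraph

variable {V β : Type*}

section Basic

/-- `u` and `v` are joined by an undirected path using only edges of `S`. -/
def Joined (G : MultiDigraph V β) (S : Set β) : V → V → Prop :=
  Relation.EqvGen fun u v => ∃ e ∈ S, G.tail e = u ∧ G.head e = v

/-- The start of an edge run forwards (`true`) or backwards (`false`). -/
def src (G : MultiDigraph V β) (d : β × Bool) : V := if d.2 then G.tail d.1 else G.head d.1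

/-- The end of an edge run forwards (`true`) or backwards (`false`). -/
def tgt (G : MultiDigraph V β) (d : β × Bool) : V := if d.2 then G.head d.1 else G.tail d.1

/-- `l` is a run around a cycle of the underlying undirected graph: a nonempty closed walk
with no repeated vertex and no repeated edge. -/
structure IsCycleRun (G : MultiDigraph V β) (l : List (β × Bool)) : Prop where
  ne_nil : l ≠ []
  mem_edges : ∀ d ∈ l, d.1 ∈ G.edges
  chain : l.IsChain fun d d' => G.tgt d = G.src d'
  closed : l.getLast?.map G.tgt = l.head?.map G.src
  nodup_vertices : (l.map G.src).Nodup
  nodup_edges : (l.map Prod.fst).Nodup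

/-- `C` is a signed cycle: the positive elements are the edges run forwards in some
running direction of a cycle, and the negative elements those run backwards. -/
def IsSignedCycle (G : MultiDigraph V β) (C : SignedSubset β) : Prop :=
  ∃ l, G.IsCycleRun l ∧ C.pos = {e | (e, true) ∈ l} ∧ C.neg = {e | (e, false) ∈ l}

/-- There is no directed cycle, i.e. no signed cycle all of whose elements are positive. -/
def IsAcyclic (G : MultiDigraph V β) : Prop :=
  ¬ ∃ C, G.IsSignedCycle C ∧ C.neg = ∅

/-- No edge enters `v`. -/
def IsSource (G : MultiDigraph V β) (v : V) : Prop := ∀ e ∈ G.edges, G.head e ≠ v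

/-- No edge leaves `v`. -/
def IsSink (G : MultiDigraph V β) (v : V) : Prop := ∀ e ∈ G.edges, G.tail e ≠ v

/-- `G` is bipolar with respect to its edge `p`: it is acyclic and has a unique source and a unique
sink, which are the extremities of `p`. (By acyclicity the source is then the tail and the sink
the head. A finite `G` with this property is connected, since each component has a source.) -/
structure IsBipolar (G : MultiDigraph V β) (p : β) : Prop where
  mem_edges : p ∈ G.edges
  acyclic : G.IsAcyclic
  source_iff : ∀ v, G.IsSource v ↔ v = G.tail p
  sink_iff : ∀ v, G.IsSink v ↔ v = G.head p

/-- `T` is (the edge set of) a spanning tree: it connects all vertices and contains no cycle. -/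
structure IsSpanningTree (G : MultiDigraph V β) (T : Finset β) : Prop where
  subset : T ⊆ G.edges
  connected : ∀ u v, G.Joined ↑T u v
  no_cycle : ∀ C, G.IsSignedCycle C → ¬ C.support ⊆ ↑T

/-- The signed cut given by a set `X` of vertices: the edges leaving `X` are positive, the edges
entering `X` are negative. -/
def signedCut (G : MultiDigraph V β) (X : Set V) : SignedSubset β where
  pos := {e | e ∈ G.edges ∧ G.tail e ∈ X ∧ G.head e ∉ X}
  neg := {e | e ∈ G.edges ∧ G.tail e ∉ X ∧ G.head e ∈ X}
  disjoint := Set.disjoint_left.2 fun _ h h' => h'.2.1 h.2.1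

/-- The signed fundamental cocycle `C*(T; t)` of an element `t` of the spanning tree `T`: the edges
between the two components of `T \ {t}`, signed so that `t` is positive. -/
def fundCocycle (G : MultiDigraph V β) (T : Finset β) (t : β) : SignedSubset β :=
  G.signedCut {v | G.Joined (↑T \ {t}) (G.tail t) v}

open Classical in
/-- The signed fundamental cycle `C(T; e)` of an edge `e` outside the spanning tree `T`: the unique
signed cycle contained in `T ∪ {e}` in which `e` is positive. -/
noncomputable def fundCycle (G : MultiDigraph V β) (T : Finset β) (e : β) : SignedSubset β :=
  if h : ∃ C, G.IsSignedCycle C ∧ C.support ⊆ insert e (T : Set β) ∧ e ∈ C.pos then h.choose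
  else SignedSubset.empty

end Basic

section Ordered

variable [LinearOrder β]

/-- Deletion `G \ w` of an edge. -/
def delete (G : MultiDigraph V β) (w : β) : MultiDigraph V β where
  edges := G.edges.erase w
  tail := G.tail
  head := G.head

/-- Contraction `G / w` of an edge: remove `w` and identify its two extremities. -/
def contract (G : MultiDigraph V β) (w : β) :
    MultiDigraph (Quot fun u v : V => u = G.tail w ∧ v = G.head w) β where
  edges := G.edges.erase w
  tail e := Quot.mk _ (G.tail e)
  head e := Quot.mk _ (G.head e)

/-- The full optimality criterion for a spanning tree `T`, edges being linearly ordered. -/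
structure IsFullyOptimal (G : MultiDigraph V β) (T : Finset β) : Prop where
  tree : G.IsSpanningTree T
  internal : ∀ b ∈ T, ¬ IsLeast (G.edges : Set β) b →
    ∃ a, IsLeast (G.fundCocycle T b).support a ∧ (G.fundCocycle T b).Opposite b a
  external : ∀ e ∈ G.edges, e ∉ T →
    ∃ a, IsLeast (G.fundCycle T e).support a ∧ (G.fundCycle T e).Opposite e a

open Classical in
/-- The fully optimal spanning tree `α(G)`: the unique spanning tree satisfying the full optimality
criterion (`∅` as a default value when there is no unique one). -/
noncomputable def alpha (G : MultiDigraph V β) : Finset β :=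
  if h : ∃! T, G.IsFullyOptimal T then h.choose else ∅

end Ordered

end MultiDigraph

/-! Signed cycles and cocycles are encoded as integral vectors indexed by the edges, namely
circulations and coboundaries of potentials. A fundamental cycle or cocycle, signed so that its
defining edge is positive, satisfies the criterion exactly when its first nonzero entry is negative
(`LexNeg`). Lexicographic negativity is stable under nonnegative combinations, and every circulation
or coboundary expands in the fundamental ones of a tree. Full optimality of `T` is therefore a
condition on all coboundaries that vanish at `p` and are nonnegative on `T`, and on all circulations
that are nonnegative off `T` (`IsOptimal`).

In this form uniqueness follows from Minty's painting lemma: two distinct optimal trees would yield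
a nonzero vector `v` with both `v` and `-v` lexicographically nonpositive (`IsOptimal.unique`).

For the induction, `ω` is the last edge, so its entry cannot decide the sign of a vector with
another nonzero entry. Hence an optimal tree `T''` of `G / ω` gives the optimal tree `T'' ∪ {ω}` of
`G` as soon as the fundamental cocycle `D` of `ω` is negative, and an optimal tree `T'` of `G \ ω`
stays optimal as soon as the fundamental cycle `C` of `ω` is negative (`IsOptimal.of_contract`,
`IsOptimal.of_delete`). If one minor is not bipolar, bipolarity of `G` forces the required sign for
the other. If both are bipolar, exactly one of `C`, `D` is negative (`IsOptimal.lexNeg_iff`): if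
both were, there would be two optimal trees; if neither were, there would be two after reversing
`ω`. The signs `ε` in `IsOptimal` serve this last reorientation. -/

/-! ### Lexicographically negative vectors -/

section Lex

variable {β : Type*} [LinearOrder β]

/-- The first nonzero entry of `v` exists and is negative. -/
def LexNeg (v : β → ℤ) : Prop := ∃ m, v m < 0 ∧ ∀ i < m, v i = 0

/-- `v` vanishes or its first nonzero entry is negative. -/
def LexNonpos (v : β → ℤ) : Prop := v = 0 ∨ LexNeg v

theorem LexNeg.ne_zero {v : β → ℤ} (h : LexNeg v) : v ≠ 0 := by
  rintro rfl
  obtain ⟨m, hm, -⟩ := h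
  simp at hm

theorem LexNeg.add {v w : β → ℤ} (hv : LexNeg v) (hw : LexNeg w) : LexNeg (v + w) := by
  obtain ⟨m, hm, hm'⟩ := hv
  obtain ⟨n, hn, hn'⟩ := hw
  rcases lt_trichotomy m n with h | rfl | h
  · exact ⟨m, by simpa [hn' m h] using hm, fun i hi => by simp [hm' i hi, hn' i (hi.trans h)]⟩
  · exact ⟨m, by simpa using add_neg hm hn, fun i hi => by simp [hm' i hi, hn' i hi]⟩
  · exact ⟨n, by simpa [hm' n h] using hn, fun i hi => by simp [hn' i hi, hm' i (hi.trans h)]⟩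

theorem LexNeg.smul {v : β → ℤ} (hv : LexNeg v) {c : ℤ} (hc : 0 < c) : LexNeg (c • v) := by
  obtain ⟨m, hm, hm'⟩ := hv
  exact ⟨m, by simpa using mul_neg_of_pos_of_neg hc hm, fun i hi => by simp [hm' i hi]⟩

theorem LexNeg.not_neg {v : β → ℤ} (hv : LexNeg v) : ¬ LexNeg (-v) := fun h =>
  (hv.add h).ne_zero (add_neg_cancel v)

theorem LexNonpos.eq_zero {v : β → ℤ} (h : LexNonpos v) (h' : LexNonpos (-v)) : v = 0 := by
  rcases h with h | h
  · exact h
  · rcases h' with h' | h'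
    · exact neg_eq_zero.1 h'
    · exact absurd h' h.not_neg

theorem LexNonpos.add {v w : β → ℤ} (hv : LexNonpos v) (hw : LexNonpos w) :
    LexNonpos (v + w) := by
  rcases hv with rfl | hv
  · simpa using hw
  · rcases hw with rfl | hw
    · exact Or.inr (by simpa using hv)
    · exact Or.inr (hv.add hw)

theorem LexNonpos.smul {v : β → ℤ} (hv : LexNonpos v) {c : ℤ} (hc : 0 ≤ c) :
    LexNonpos (c • v) := by
  rcases hv with rfl | hv
  · exact Or.inl (smul_zero c)
  · rcases hc.eq_or_lt with rfl | hc
    · exact Or.inl (zero_smul ℤ v)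
    · exact Or.inr (hv.smul hc)

theorem LexNonpos.sum {ι : Type*} (s : Finset ι) (v : ι → β → ℤ)
    (h : ∀ i ∈ s, LexNonpos (v i)) : LexNonpos (∑ i ∈ s, v i) :=
  Finset.sum_induction v LexNonpos (fun _ _ => LexNonpos.add) (Or.inl rfl) h

/-- A nonzero vector with finite support is lexicographically negative or positive. -/
theorem lexNeg_or_lexNeg_neg (E : Finset β) {v : β → ℤ} (hE : ∀ e ∉ E, v e = 0) (hv : v ≠ 0) :
    LexNeg v ∨ LexNeg (-v) := by
  have hne : (E.filter fun e => v e ≠ 0).Nonempty := by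
    obtain ⟨e, he⟩ := Function.ne_iff.1 hv
    exact ⟨e, Finset.mem_filter.2 ⟨by_contra fun h => he (hE e h), he⟩⟩
  set m := (E.filter fun e => v e ≠ 0).min' hne with hm
  have hmem := Finset.min'_mem _ hne
  rw [← hm, Finset.mem_filter] at hmem
  have hlt : ∀ i < m, v i = 0 := fun i hi => by
    by_contra h
    exact absurd (Finset.min'_le _ i
      (Finset.mem_filter.2 ⟨by_contra fun h' => h (hE i h'), h⟩)) (not_le.2 hi)
  rcases lt_or_gt_of_ne hmem.2 with h | h
  · exact Or.inl ⟨m, h, hlt⟩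
  · exact Or.inr ⟨m, by simpa using h, fun i hi => by simp [hlt i hi]⟩

/-- Changing the entry at an upper bound of the support other than the first nonzero entry
keeps a vector lexicographically negative. -/
theorem LexNeg.of_eq_of_ne {v w : β → ℤ} {ω : β} (hv : LexNeg v) (hvω : ∀ e, ω < e → v e = 0)
    (hω : ∃ e, e ≠ ω ∧ v e ≠ 0) (h : ∀ e, e ≠ ω → w e = v e) : LexNeg w := by
  obtain ⟨m, hm, hm'⟩ := hv
  have hmω : m < ω := by
    rcases lt_trichotomy m ω with h1 | rfl | h1
    · exact h1
    · obtain ⟨e, he, he'⟩ := hω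
      rcases lt_or_gt_of_ne he with h2 | h2
      · exact absurd (hm' e h2) he'
      · exact absurd (hvω e h2) he'
    · exact absurd (hvω m h1) hm.ne
  exact ⟨m, by rwa [h m hmω.ne], fun i hi => by rw [h i (hi.trans hmω).ne, hm' i hi]⟩

/-- Since `s * s = 1`, the vector `c • v` is the nonnegative multiple `s * c` of `s • v`. -/
theorem smul_lexNonpos_of_sign {s c : ℤ} (hs : s = 1 ∨ s = -1) (hc : 0 ≤ s * c) {v : β → ℤ}
    (hv : LexNeg (s • v)) : LexNonpos (c • v) := by
  rcases hs with rfl | rfl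
  · exact LexNonpos.smul (Or.inr (by simpa using hv)) (by simpa using hc)
  · have := LexNonpos.smul (v := -v) (Or.inr (by simpa using hv)) (c := -c) (by simpa using hc)
    simpa using this

/-- A lexicographically negative vector that is nonnegative except at an upper bound `ω` of its
support is nonpositive. -/
theorem LexNeg.nonpos_of_nonneg_of_ne {v : β → ℤ} {ω : β} (hv : LexNeg v)
    (hvω : ∀ e, ω < e → v e = 0) (h0 : ∀ e, e ≠ ω → 0 ≤ v e) (e : β) : v e ≤ 0 := by
  obtain ⟨m, hm, hm'⟩ := hv
  have : m = ω := by_contra fun h => absurd (h0 m h) (not_le.2 hm)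
  subst this
  rcases lt_trichotomy e m with h | rfl | h
  · rw [hm' e h]
  · exact hm.le
  · rw [hvω e h]

end Lex

namespace MultiDigraph

variable {V β : Type*}

/-! ### Circulations and coboundaries -/

section Linear

/-- The pairing of an edge vector with the coboundary of a potential. -/
def pair (G : MultiDigraph V β) (x : β → ℤ) (π : V → ℤ) : ℤ :=
  ∑ e ∈ G.edges, x e * (π (G.tail e) - π (G.head e))

/-- `x` is a unit flow from `u` to `v`, orthogonal conditions being tested on all potentials. -/
structure IsFlow (G : MultiDigraph V β) (x : β → ℤ) (u v : V) : Prop where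
  zero : ∀ e ∉ G.edges, x e = 0
  pair_eq : ∀ π, G.pair x π = π u - π v

/-- `x` is a circulation: an integral vector of the cycle space. -/
structure IsCirculation (G : MultiDigraph V β) (x : β → ℤ) : Prop where
  zero : ∀ e ∉ G.edges, x e = 0
  pair_eq : ∀ π, G.pair x π = 0

open Classical in
/-- The coboundary of a potential: an integral vector of the cocycle space. -/
noncomputable def cob (G : MultiDigraph V β) (π : V → ℤ) (e : β) : ℤ :=
  if e ∈ G.edges then π (G.tail e) - π (G.head e) else 0

variable {G : MultiDigraph V β}

theorem cob_of_mem {e : β} (he : e ∈ G.edges) (π : V → ℤ) :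
    G.cob π e = π (G.tail e) - π (G.head e) := if_pos he

theorem cob_of_notMem {e : β} (he : e ∉ G.edges) (π : V → ℤ) : G.cob π e = 0 := if_neg he

theorem cob_add (π π' : V → ℤ) : G.cob (π + π') = G.cob π + G.cob π' := by
  ext e
  by_cases he : e ∈ G.edges
  · simp [cob_of_mem he]; ring
  · simp [cob_of_notMem he]

theorem cob_smul (c : ℤ) (π : V → ℤ) : G.cob (c • π) = c • G.cob π := by
  ext e
  by_cases he : e ∈ G.edges
  · simp [cob_of_mem he]; ring
  · simp [cob_of_notMem he]

theorem cob_neg (π : V → ℤ) : G.cob (-π) = -G.cob π := by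
  simpa using cob_smul (G := G) (-1) π

theorem cob_sub (π π' : V → ℤ) : G.cob (π - π') = G.cob π - G.cob π' := by
  rw [sub_eq_add_neg, cob_add, cob_neg, sub_eq_add_neg]

theorem cob_sum {ι : Type*} (s : Finset ι) (π : ι → V → ℤ) :
    G.cob (∑ i ∈ s, π i) = ∑ i ∈ s, G.cob (π i) := by
  classical
  induction s using Finset.induction_on with
  | empty => simpa using cob_smul (G := G) 0 0
  | insert a s ha ih => rw [Finset.sum_insert ha, Finset.sum_insert ha, cob_add, ih]

theorem pair_add (x x' : β → ℤ) (π : V → ℤ) : G.pair (x + x') π = G.pair x π + G.pair x' π := by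
  simp [pair, add_mul, Finset.sum_add_distrib]

theorem pair_smul (c : ℤ) (x : β → ℤ) (π : V → ℤ) : G.pair (c • x) π = c * G.pair x π := by
  simp [pair, mul_assoc, Finset.mul_sum]

theorem pair_eq_sum_cob (x : β → ℤ) (π : V → ℤ) :
    G.pair x π = ∑ e ∈ G.edges, x e * G.cob π e :=
  Finset.sum_congr rfl fun _ he => by rw [cob_of_mem he]

theorem IsCirculation.add {x x' : β → ℤ} (h : G.IsCirculation x) (h' : G.IsCirculation x') :
    G.IsCirculation (x + x') :=
  ⟨fun e he => by simp [h.zero e he, h'.zero e he],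
    fun π => by rw [pair_add, h.pair_eq, h'.pair_eq, add_zero]⟩

theorem IsCirculation.smul {x : β → ℤ} (h : G.IsCirculation x) (c : ℤ) :
    G.IsCirculation (c • x) :=
  ⟨fun e he => by simp [h.zero e he], fun π => by rw [pair_smul, h.pair_eq, mul_zero]⟩

theorem IsCirculation.neg {x : β → ℤ} (h : G.IsCirculation x) : G.IsCirculation (-x) := by
  simpa using h.smul (-1)

theorem IsCirculation.sub {x x' : β → ℤ} (h : G.IsCirculation x) (h' : G.IsCirculation x') :
    G.IsCirculation (x - x') := by
  simpa [sub_eq_add_neg] using h.add h'.neg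

theorem isCirculation_zero : G.IsCirculation 0 := ⟨fun _ _ => rfl, fun π => by simp [pair]⟩

theorem IsCirculation.sum {ι : Type*} (s : Finset ι) (x : ι → β → ℤ)
    (h : ∀ i ∈ s, G.IsCirculation (x i)) : G.IsCirculation (∑ i ∈ s, x i) :=
  Finset.sum_induction x G.IsCirculation (fun _ _ => IsCirculation.add) isCirculation_zero h

theorem isFlow_zero (u : V) : G.IsFlow 0 u u := ⟨fun _ _ => rfl, fun π => by simp [pair]⟩

theorem IsFlow.add {x x' : β → ℤ} {u v w : V} (h : G.IsFlow x u v) (h' : G.IsFlow x' v w) :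
    G.IsFlow (x + x') u w :=
  ⟨fun e he => by simp [h.zero e he, h'.zero e he],
    fun π => by rw [pair_add, h.pair_eq, h'.pair_eq]; ring⟩

theorem IsFlow.neg {x : β → ℤ} {u v : V} (h : G.IsFlow x u v) : G.IsFlow (-x) v u :=
  ⟨fun e he => by simp [h.zero e he], fun π => by
    have := pair_smul (G := G) (-1) x π
    rw [h.pair_eq] at this
    rw [← neg_one_smul ℤ x, this]; ring⟩

theorem IsFlow.isCirculation {x : β → ℤ} {u : V} (h : G.IsFlow x u u) : G.IsCirculation x :=
  ⟨h.zero, fun π => by rw [h.pair_eq, sub_self]⟩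

open Classical in
theorem pair_single {e : β} (he : e ∈ G.edges) (c : ℤ) (π : V → ℤ) :
    G.pair (Pi.single e c) π = c * (π (G.tail e) - π (G.head e)) := by
  rw [pair, Finset.sum_eq_single_of_mem e he]
  · simp
  · intro f _ hf
    simp [hf]

open Classical in
theorem isFlow_single {e : β} (he : e ∈ G.edges) :
    G.IsFlow (Pi.single e 1) (G.tail e) (G.head e) :=
  ⟨fun f hf => Pi.single_eq_of_ne (by rintro rfl; exact hf he) _,
    fun π => by rw [pair_single he, one_mul]⟩

/-- A finite form of Minty's painting lemma: the edges of `S₁` being oriented by the signs `σ`, those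
of `S₀` being free and the others being forbidden, an edge of `S₁` lies in a compatible circulation
or in a compatible coboundary. -/
theorem minty (S₀ S₁ : Set β) (h₀ : S₀ ⊆ G.edges) (h₁ : S₁ ⊆ G.edges)
    (σ : β → ℤ) (hσ : ∀ e, σ e = 1 ∨ σ e = -1) {a : β} (ha : a ∈ S₁) (ha₀ : a ∉ S₀) :
    (∃ x, G.IsCirculation x ∧ (∀ e ∉ S₀, e ∉ S₁ → x e = 0) ∧
      (∀ e ∉ S₀, 0 ≤ σ e * x e) ∧ x a ≠ 0) ∨
    (∃ π, (∀ e ∈ S₀, G.cob π e = 0) ∧ (∀ e ∈ S₁, 0 ≤ σ e * G.cob π e) ∧ G.cob π a ≠ 0) := by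
  classical
  let s : β → V := fun e => if σ e = 1 then G.tail e else G.head e
  let t : β → V := fun e => if σ e = 1 then G.head e else G.tail e
  have hst : ∀ e ∈ G.edges, G.IsFlow (Pi.single e (σ e)) (s e) (t e) := by
    intro e he
    rcases hσ e with h | h
    · simpa [s, t, h] using isFlow_single he
    · have := (isFlow_single he).neg
      rw [← Pi.single_neg] at this
      simpa [s, t, h] using this
  -- Free edges may be crossed both ways, those of `S₁` only along `σ`. Either the start of `a` is
  -- reachable from its end, and closing the walk with `a` gives a circulation, or the reachable set
  -- defines a cut.
  let R : V → V → Prop := fun u v => (∃ e ∈ S₀, (G.tail e = u ∧ G.head e = v) ∨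
    (G.head e = u ∧ G.tail e = v)) ∨ ∃ e ∈ S₁, s e = u ∧ t e = v
  have hflow : ∀ u v, Relation.ReflTransGen R u v → ∃ x, G.IsFlow x u v ∧
      (∀ e ∉ S₀, e ∉ S₁ → x e = 0) ∧ (∀ e ∉ S₀, 0 ≤ σ e * x e) := by
    intro u v h
    induction h with
    | refl => exact ⟨0, isFlow_zero u, by simp, by simp⟩
    | @tail v₁ v₂ _ hR ih =>
      obtain ⟨x, hx, hx0, hx1⟩ := ih
      rcases hR with ⟨e, he, h⟩ | ⟨e, he, rfl, rfl⟩
      · obtain ⟨c, hc⟩ : ∃ c : ℤ, G.IsFlow (Pi.single e c) v₁ v₂ := by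
          rcases h with ⟨rfl, rfl⟩ | ⟨rfl, rfl⟩
          · exact ⟨1, isFlow_single (h₀ he)⟩
          · refine ⟨-1, ?_⟩
            have := (isFlow_single (h₀ he)).neg
            rwa [← Pi.single_neg] at this
        refine ⟨x + Pi.single e c, hx.add hc, fun f hf hf1 => ?_, fun f hf => ?_⟩
        · have : f ≠ e := by rintro rfl; exact hf he
          simp [this, hx0 f hf hf1]
        · have : f ≠ e := by rintro rfl; exact hf he
          simpa [this] using hx1 f hf
      · refine ⟨x + Pi.single e (σ e), hx.add (hst e (h₁ he)), fun f hf hf1 => ?_, fun f hf => ?_⟩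
        · have : f ≠ e := by rintro rfl; exact hf1 he
          simp [this, hx0 f hf hf1]
        · rw [Pi.add_apply, mul_add]
          refine add_nonneg (hx1 f hf) ?_
          by_cases hfe : f = e
          · subst hfe
            simpa using mul_self_nonneg (σ f)
          · simp [hfe]
  by_cases hr : Relation.ReflTransGen R (t a) (s a)
  · left
    obtain ⟨x, hx, hx0, hx1⟩ := hflow _ _ hr
    refine ⟨x + Pi.single a (σ a), (hx.add (hst a (h₁ ha))).isCirculation, fun f hf hf1 => ?_,
      fun f hf => ?_, ?_⟩
    · have : f ≠ a := by rintro rfl; exact hf1 ha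
      simp [this, hx0 f hf hf1]
    · rw [Pi.add_apply, mul_add]
      refine add_nonneg (hx1 f hf) ?_
      by_cases hfe : f = a
      · subst hfe
        simpa using mul_self_nonneg (σ f)
      · simp [hfe]
    · have := hx1 a ha₀
      rcases hσ a with h | h <;> simp [h] at this ⊢ <;> omega
  · right
    -- The value -1 on reachable vertices makes `π` nonincreasing along `R`, hence constant along
    -- free edges; it drops along `a`, whose end is reachable while its start is not.
    let π : V → ℤ := fun w => if Relation.ReflTransGen R (t a) w then -1 else 0
    have hπ : ∀ u v, R u v → π v ≤ π u := by
      intro u v huv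
      by_cases h : Relation.ReflTransGen R (t a) u
      · simp [π, h, h.tail huv]
      · simp only [π, h, if_false]
        split_ifs <;> simp
    have hπst : ∀ e ∈ G.edges, σ e * G.cob π e = π (s e) - π (t e) := by
      intro e he
      rcases hσ e with h | h <;> simp [s, t, h, cob_of_mem he]
    refine ⟨π, fun e he => ?_, fun e he => ?_, fun h => ?_⟩
    · rw [cob_of_mem (h₀ he)]
      have h1 := hπ _ _ (Or.inl ⟨e, he, Or.inl ⟨rfl, rfl⟩⟩)
      have h2 := hπ _ _ (Or.inl ⟨e, he, Or.inr ⟨rfl, rfl⟩⟩)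
      omega
    · rw [hπst e (h₁ he)]
      have := hπ _ _ (Or.inr ⟨e, he, rfl, rfl⟩)
      omega
    · have h1 := hπst a (h₁ ha)
      rw [h, mul_zero] at h1
      simp [π, hr, Relation.ReflTransGen.refl] at h1

/-- A linear form of the definition of spanning trees. -/
structure IsTree (G : MultiDigraph V β) (T : Finset β) : Prop where
  subset : T ⊆ G.edges
  const : ∀ π : V → ℤ, (∀ e ∈ T, G.cob π e = 0) → ∀ u v, π u = π v
  indep : ∀ x, G.IsCirculation x → (∀ e ∉ T, x e = 0) → x = 0

theorem IsTree.cob_eq_zero {T : Finset β} (hT : G.IsTree T) {π : V → ℤ}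
    (h : ∀ e ∈ T, G.cob π e = 0) : G.cob π = 0 := by
  ext e
  by_cases he : e ∈ G.edges
  · simp [cob_of_mem he, hT.const π h (G.tail e) (G.head e)]
  · simp [cob_of_notMem he]

/-- A linear form of the definition of bipolar digraphs. -/
structure IsLinBipolar (G : MultiDigraph V β) (p : β) : Prop where
  mem : p ∈ G.edges
  circ : ∀ x, G.IsCirculation x → (∀ e, 0 ≤ x e) → x = 0
  cocirc : ∀ π, (∀ e, 0 ≤ G.cob π e) → G.cob π p = 0 → G.cob π = 0
  const : ∀ π : V → ℤ, G.cob π = 0 → ∀ u v, π u = π v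

theorem IsLinBipolar.tail_ne_head {p e : β} (h : G.IsLinBipolar p) (he : e ∈ G.edges) :
    G.tail e ≠ G.head e := by
  classical
  intro hl
  have h1 := isFlow_single he
  rw [hl] at h1
  have h2 := congrFun (h.circ _ h1.isCirculation fun f => by
    by_cases hf : f = e
    · subst hf; simp
    · simp [hf]) e
  simp at h2

/-- Potentials of `G / ω` are the potentials of `G` whose coboundary vanishes on `ω`. -/
theorem exists_contract_potential {ω : β} (hω : ω ∈ G.edges) {π : V → ℤ} (h : G.cob π ω = 0) :
    ∃ π' : (Quot fun u v : V => u = G.tail ω ∧ v = G.head ω) → ℤ,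
      ∀ v, π' (Quot.mk _ v) = π v := by
  rw [cob_of_mem hω, sub_eq_zero] at h
  exact ⟨Quot.lift π (by rintro _ _ ⟨rfl, rfl⟩; exact h), fun _ => rfl⟩

end Linear

/-! ### Linear form of the full optimality criterion -/

section Optimal

variable [LinearOrder β] {G : MultiDigraph V β}

/-- The full optimality criterion extended to all conformal vectors of the cycle and cocycle
spaces, after the reorientation given by the signs `ε`. -/
structure IsOptimal (G : MultiDigraph V β) (ε : β → ℤ) (p : β) (T : Finset β) : Prop where
  tree : G.IsTree T
  mem : p ∈ T
  cob_nonpos : ∀ π, G.cob π p = 0 → (∀ b ∈ T, 0 ≤ ε b * G.cob π b) → LexNonpos (G.cob π)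
  circ_nonpos : ∀ x, G.IsCirculation x → (∀ e ∉ T, 0 ≤ ε e * x e) → LexNonpos x

/-- Minty's lemma is applied with the common edges free, the symmetric difference oriented by `ε` on
the `T₁` side and by `-ε` on the `T₂` side, and all other edges forbidden in circulations. A
compatible circulation `x` is tested against `T₂`, and `-x` against `T₁`; for coboundaries the roles
are exchanged. Both signs being nonpositive, the vector vanishes, although it is nonzero at `a`. -/
theorem IsOptimal.unique {ε : β → ℤ} (hε : ∀ e, ε e = 1 ∨ ε e = -1) {p : β} {T₁ T₂ : Finset β}
    (h₁ : G.IsOptimal ε p T₁) (h₂ : G.IsOptimal ε p T₂) : T₁ = T₂ := by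
  by_contra hne
  obtain ⟨a, ha⟩ : ∃ a, ¬ (a ∈ T₁ ↔ a ∈ T₂) := by
    by_contra! h
    exact hne (Finset.ext h)
  rcases minty (G := G) {e | e ∈ T₁ ∧ e ∈ T₂} {e | ¬ (e ∈ T₁ ↔ e ∈ T₂)}
    (fun e he => h₁.tree.subset he.1)
    (fun e he => by
      by_cases h : e ∈ T₁
      · exact h₁.tree.subset h
      · exact h₂.tree.subset (by simp only [Set.mem_ofPred_eq] at he; tauto))
    (fun e => if e ∈ T₁ then ε e else -ε e)
    (fun e => by rcases hε e with h | h <;> simp only [h] <;> split_ifs <;> simp)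
    (a := a) ha (fun h => ha (by simp only [Set.mem_ofPred_eq] at h; tauto))
    with ⟨x, hx, hx0, hx1, hxa⟩ | ⟨π, hπ0, hπ1, hπa⟩
  · refine hxa (congrFun (LexNonpos.eq_zero (h₂.circ_nonpos x hx fun e he => ?_)
      (h₁.circ_nonpos (-x) hx.neg fun e he => ?_)) a)
    · by_cases h : e ∈ T₁
      · simpa [h, he] using hx1 e
      · simp [hx0 e (by simp [h]) (by simp [h, he])]
    · by_cases h : e ∈ T₂
      · simpa [h, he] using hx1 e
      · simp [hx0 e (by simp [h]) (by simp [h, he])]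
  · have hp : G.cob π p = 0 := hπ0 p ⟨h₁.mem, h₂.mem⟩
    refine hπa (congrFun (LexNonpos.eq_zero (h₁.cob_nonpos π hp fun e he => ?_)
      (cob_neg (G := G) π ▸ h₂.cob_nonpos (-π) (by simp [cob_neg, hp]) fun e he => ?_)) a)
    · by_cases h : e ∈ T₂
      · simp [hπ0 e ⟨he, h⟩]
      · simpa [h, he] using hπ1 e
    · by_cases h : e ∈ T₁
      · simp [cob_neg, hπ0 e ⟨h, he⟩]
      · simpa [cob_neg, h, he] using hπ1 e

end Optimal

/-! ### Minors -/

section Minors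

variable [LinearOrder β] {G : MultiDigraph V β} {ω : β}

theorem mem_edges_contract {e : β} : e ∈ (G.contract ω).edges ↔ e ≠ ω ∧ e ∈ G.edges :=
  Finset.mem_erase

theorem mem_edges_delete {e : β} : e ∈ (G.delete ω).edges ↔ e ≠ ω ∧ e ∈ G.edges :=
  Finset.mem_erase

theorem cob_contract (π' : (Quot fun u v : V => u = G.tail ω ∧ v = G.head ω) → ℤ) :
    (G.contract ω).cob π' = G.cob fun v => π' (Quot.mk _ v) := by
  ext e
  by_cases he : e ∈ (G.contract ω).edges
  · rw [cob_of_mem he, cob_of_mem (mem_edges_contract.1 he).2]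
    rfl
  · rw [cob_of_notMem he]
    by_cases h : e ∈ G.edges
    · have heω : e = ω := by_contra fun h' => he (mem_edges_contract.2 ⟨h', h⟩)
      subst heω
      rw [cob_of_mem h, Quot.sound (r := fun u v : V => u = G.tail e ∧ v = G.head e) ⟨rfl, rfl⟩,
        sub_self]
    · rw [cob_of_notMem h]

theorem pair_contract {x : β → ℤ} (hω : x ω = 0)
    (π' : (Quot fun u v : V => u = G.tail ω ∧ v = G.head ω) → ℤ) :
    (G.contract ω).pair x π' = G.pair x fun v => π' (Quot.mk _ v) :=
  Finset.sum_erase _ (by simp [hω])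

theorem cob_delete_of_ne {e : β} (he : e ≠ ω) (π : V → ℤ) :
    (G.delete ω).cob π e = G.cob π e := by
  by_cases h : e ∈ G.edges
  · rw [cob_of_mem h, cob_of_mem (mem_edges_delete.2 ⟨he, h⟩)]
    rfl
  · rw [cob_of_notMem h, cob_of_notMem fun h' => h (mem_edges_delete.1 h').2]

theorem cob_delete_self (π : V → ℤ) : (G.delete ω).cob π ω = 0 :=
  cob_of_notMem (fun h => (mem_edges_delete.1 h).1 rfl) π

theorem pair_delete {x : β → ℤ} (hω : x ω = 0) (π : V → ℤ) :
    (G.delete ω).pair x π = G.pair x π :=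
  Finset.sum_erase _ (by simp [hω])

theorem IsCirculation.delete {x : β → ℤ} (hx : G.IsCirculation x) (hω : x ω = 0) :
    (G.delete ω).IsCirculation x :=
  ⟨fun e he => by
    by_cases h : e = ω
    · rw [h, hω]
    · exact hx.zero e fun h' => he (mem_edges_delete.2 ⟨h, h'⟩),
    fun π => by rw [pair_delete hω, hx.pair_eq]⟩

theorem IsCirculation.delete_self {x : β → ℤ} (hx : (G.delete ω).IsCirculation x) : x ω = 0 :=
  hx.zero ω fun h => (mem_edges_delete.1 h).1 rfl

theorem IsCirculation.of_delete {x : β → ℤ} (hx : (G.delete ω).IsCirculation x) :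
    G.IsCirculation x :=
  ⟨fun e he => hx.zero e fun h => he (mem_edges_delete.1 h).2,
    fun π => by rw [← pair_delete hx.delete_self, hx.pair_eq]⟩

theorem IsCirculation.contract_self {x : β → ℤ} (hx : (G.contract ω).IsCirculation x) :
    x ω = 0 :=
  hx.zero ω fun h => (mem_edges_contract.1 h).1 rfl

theorem pair_add_single (hω : ω ∈ G.edges) (x : β → ℤ) (c : ℤ) (π : V → ℤ) :
    G.pair (x + Pi.single ω c) π = G.pair x π + c * G.cob π ω := by
  rw [pair_add, cob_of_mem hω, ← pair_single hω]
  congr!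

/-- Potentials of the contraction do not see `ω`, so its entry can be reset to zero. -/
theorem IsCirculation.contract (hω : ω ∈ G.edges) {x : β → ℤ} (hx : G.IsCirculation x) :
    (G.contract ω).IsCirculation (x + Pi.single ω (-x ω)) := by
  refine ⟨fun e he => ?_, fun π' => ?_⟩
  · by_cases h : e = ω
    · simp [h]
    · simp [h, hx.zero e fun h' => he (mem_edges_contract.2 ⟨h, h'⟩)]
  · rw [pair_contract (by simp), pair_add_single hω, hx.pair_eq, ← cob_contract,
      cob_of_notMem fun h => (mem_edges_contract.1 h).1 rfl]
    simp

/-- Circulations of `G / ω` lift to circulations of `G`. -/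
theorem IsCirculation.exists_of_contract (hω : ω ∈ G.edges) (hl : G.tail ω ≠ G.head ω)
    {x : β → ℤ} (hx : (G.contract ω).IsCirculation x) :
    ∃ c, G.IsCirculation (x + Pi.single ω c) := by
  classical
  -- Pairing with the indicator of the tail of `ω`, whose coboundary is 1 on `ω`, forces this value.
  refine ⟨-G.pair x (Pi.single (G.tail ω) 1), fun e he => ?_, fun π => ?_⟩
  · have h : e ≠ ω := by rintro rfl; exact he hω
    simp [h, hx.zero e fun h' => he (mem_edges_contract.1 h').2]
  · have h1 : G.cob (Pi.single (G.tail ω) 1 : V → ℤ) ω = 1 := by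
      rw [cob_of_mem hω]; simp [hl.symm]
    -- Subtracting a multiple of that indicator makes any potential descend to the contraction,
    -- where `x` pairs to zero.
    obtain ⟨π', hπ'⟩ := exists_contract_potential hω
      (π := π - G.cob π ω • (Pi.single (G.tail ω) 1 : V → ℤ)) (by
        rw [cob_sub, cob_smul]; simp [h1])
    have h2 := pair_contract hx.contract_self π'
    rw [hx.pair_eq, pair_eq_sum_cob, funext hπ', cob_sub, cob_smul] at h2
    simp only [Pi.sub_apply, Pi.smul_apply, smul_eq_mul, mul_sub, Finset.sum_sub_distrib] at h2
    rw [← pair_eq_sum_cob, sub_eq_add_neg] at h2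
    rw [pair_add_single hω, h2, pair_eq_sum_cob x (Pi.single _ _)]
    congr 1
    rw [neg_mul, Finset.sum_mul]
    congr 1
    exact Finset.sum_congr rfl fun e _ => by ring

/-- Coboundaries of `G / ω` are coboundaries of `G`, so contraction can only destroy acyclicity. A
nonnegative circulation of `G / ω` lifts to `G`, and acyclicity of `G` forces a negative entry at
`ω`. -/
theorem exists_circulation_of_not_contract {p : β} (hG : G.IsLinBipolar p) (hω : ω ∈ G.edges)
    (hpω : p ≠ ω) (h : ¬ (G.contract ω).IsLinBipolar p) :
    ∃ x, G.IsCirculation x ∧ (∀ e, e ≠ ω → 0 ≤ x e) ∧ x ω < 0 := by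
  by_contra! hno
  refine h ⟨mem_edges_contract.2 ⟨hpω, hG.mem⟩, fun x hx hx0 => ?_, fun π' h0 hp => ?_,
    fun π' h0 u v => ?_⟩
  · obtain ⟨c, hc⟩ := hx.exists_of_contract hω (hG.tail_ne_head hω)
    have h1 : ∀ e, e ≠ ω → 0 ≤ (x + Pi.single ω c : β → ℤ) e := fun e he => by
      simpa [he] using hx0 e
    have h2 := hno _ hc h1
    have h3 := hG.circ _ hc fun e => by
      by_cases he : e = ω
      · rwa [he]
      · exact h1 e he
    ext e
    by_cases he : e = ω
    · rw [he, hx.contract_self]; rfl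
    · simpa [he] using congrFun h3 e
  · rw [cob_contract] at *
    exact hG.cocirc _ h0 hp
  · rw [cob_contract] at h0
    induction u using Quot.ind
    induction v using Quot.ind
    exact hG.const _ h0 _ _

/-- Dually, circulations of `G \ ω` are circulations of `G`, so deletion can only destroy the
conditions on potentials; either failure yields a potential whose coboundary is negative at `ω`
alone. -/
theorem exists_cob_of_not_delete {p : β} (hG : G.IsLinBipolar p)
    (hpω : p ≠ ω) (h : ¬ (G.delete ω).IsLinBipolar p) :
    ∃ π, G.cob π p = 0 ∧ (∀ e, e ≠ ω → 0 ≤ G.cob π e) ∧ G.cob π ω < 0 := by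
  by_contra! hno
  have key : ∀ π, (∀ e, 0 ≤ (G.delete ω).cob π e) → (G.delete ω).cob π p = 0 →
      G.cob π = 0 := fun π h0 hp => by
    rw [cob_delete_of_ne hpω] at hp
    have h1 : ∀ e, e ≠ ω → 0 ≤ G.cob π e := fun e he => by
      rw [← cob_delete_of_ne he]; exact h0 e
    have h2 := hno π hp h1
    exact hG.cocirc π (fun e => by
      by_cases he : e = ω
      · rwa [he]
      · exact h1 e he) hp
  refine h ⟨mem_edges_delete.2 ⟨hpω, hG.mem⟩, fun x hx => hG.circ x hx.of_delete,
    fun π h0 hp => ?_, fun π h0 => hG.const π (key π (by simp [h0]) (by simp [h0]))⟩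
  ext e
  by_cases he : e = ω
  · rw [he, cob_delete_self]; rfl
  · rw [cob_delete_of_ne he, key π h0 hp]

/-- If both minors failed, the two witnesses would be orthogonal, yet their products are nonnegative
off `ω` and positive at `ω`. -/
theorem IsLinBipolar.contract_or_delete {p : β} (hG : G.IsLinBipolar p) (hω : ω ∈ G.edges)
    (hpω : p ≠ ω) : (G.contract ω).IsLinBipolar p ∨ (G.delete ω).IsLinBipolar p := by
  by_contra! h
  obtain ⟨x, hx, hx0, hxω⟩ := exists_circulation_of_not_contract hG hω hpω h.1
  obtain ⟨π, -, hπ0, hπω⟩ := exists_cob_of_not_delete hG hpω h.2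
  have h1 := hx.pair_eq π
  rw [pair_eq_sum_cob, ← Finset.add_sum_erase _ _ hω] at h1
  have h2 : 0 ≤ ∑ e ∈ G.edges.erase ω, x e * G.cob π e :=
    Finset.sum_nonneg fun e he =>
      mul_nonneg (hx0 e (Finset.ne_of_mem_erase he)) (hπ0 e (Finset.ne_of_mem_erase he))
  have h3 := mul_pos_of_neg_of_neg hxω hπω
  omega

theorem IsTree.of_contract {T : Finset β} (hω : ω ∈ G.edges) (hl : G.tail ω ≠ G.head ω)
    (hT : (G.contract ω).IsTree T) : G.IsTree (insert ω T) := by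
  refine ⟨fun e he => ?_, fun π hπ u v => ?_, fun x hx hx0 => ?_⟩
  · rcases Finset.mem_insert.1 he with rfl | he
    · exact hω
    · exact (mem_edges_contract.1 (hT.subset he)).2
  · obtain ⟨π', hπ'⟩ := exists_contract_potential hω (hπ ω (Finset.mem_insert_self _ _))
    have := hT.const π' (fun e he => by
      rw [cob_contract, funext hπ']
      exact hπ e (Finset.mem_insert_of_mem he)) (Quot.mk _ u) (Quot.mk _ v)
    rwa [hπ', hπ'] at this
  · classical
    have h1 := hT.indep _ (hx.contract hω) fun e he => by
      by_cases h : e = ω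
      · simp [h]
      · simp [h, hx0 e (by simp [h, he])]
    have h2 : x = Pi.single ω (x ω) := by
      rw [Pi.single_neg, ← sub_eq_add_neg, sub_eq_zero] at h1
      exact h1
    -- Only the entry at `ω` is left, and a multiple of a single edge that is not a loop is a
    -- circulation only if it is zero.
    have h3 : G.pair x (Pi.single (G.tail ω) 1) = 0 := hx.pair_eq _
    rw [h2, ← zero_add (Pi.single ω (x ω) : β → ℤ), pair_add_single hω, cob_of_mem hω] at h3
    simp [pair, hl.symm] at h3
    rw [h2, h3, Pi.single_zero]

theorem IsTree.of_delete {T : Finset β} (hT : (G.delete ω).IsTree T) : G.IsTree T :=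
  ⟨fun _ he => (mem_edges_delete.1 (hT.subset he)).2,
    fun π hπ => hT.const π fun e he => by
      rw [cob_delete_of_ne (mem_edges_delete.1 (hT.subset he)).1, hπ e he],
    fun x hx hx0 => hT.indep x
      (hx.delete (hx0 ω fun h => (mem_edges_delete.1 (hT.subset h)).1 rfl)) hx0⟩

/-! ### Lifting optimal trees from the minors -/

/-- The part of a coboundary of `G` left after subtracting a multiple of a coboundary with value `1`
on `ω` is lexicographically nonpositive when `T` is optimal for `G / ω`. -/
theorem IsOptimal.contract_cob_sub {p : β} {T : Finset β} (hT : (G.contract ω).IsOptimal 1 p T)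
    (hω : ω ∈ G.edges) {π₀ : V → ℤ} (h₀ : G.cob π₀ ω = 1) (h₀T : ∀ b ∈ T, G.cob π₀ b = 0)
    {π : V → ℤ} (hp : G.cob π p = 0) (hπ : ∀ b ∈ T, 0 ≤ G.cob π b) :
    LexNonpos (G.cob π - G.cob π ω • G.cob π₀) := by
  obtain ⟨π', hπ'⟩ := exists_contract_potential hω (π := π - G.cob π ω • π₀) (by
    rw [cob_sub, cob_smul]; simp [h₀])
  have h := hT.cob_nonpos π'
  rw [cob_contract, funext hπ', cob_sub, cob_smul] at h
  refine h (by simp [hp, h₀T p hT.mem]) fun b hb => ?_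
  simpa [h₀T b hb] using hπ b hb

/-- Dual of `IsOptimal.contract_cob_sub`: the difference vanishes on `ω`, so it is a circulation of
the deletion, and off `T` it keeps the signs of `x`. -/
theorem IsOptimal.delete_circ_sub {p : β} {T : Finset β} (hT : (G.delete ω).IsOptimal 1 p T)
    {x₀ : β → ℤ} (hx₀ : G.IsCirculation x₀) (h₀ : x₀ ω = 1)
    (h₀T : ∀ e, e ≠ ω → e ∉ T → x₀ e = 0) {x : β → ℤ} (hx : G.IsCirculation x)
    (hx0 : ∀ e, e ≠ ω → e ∉ T → 0 ≤ x e) : LexNonpos (x - x ω • x₀) := by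
  refine hT.circ_nonpos _ ((hx.sub (hx₀.smul _)).delete (by simp [h₀])) fun e he => ?_
  by_cases h : e = ω
  · simp [h, h₀]
  · simpa [h₀T e h he] using hx0 e h he

/-- A coboundary splits into a part living on `G / ω` and a multiple of `G.cob π₀` whose coefficient
has the sign `ε ω`. A circulation differs from one of `G / ω` only in the last entry, which does not
affect the first nonzero one. The sign at `ω` is left free so that the reoriented graph is covered
too. -/
theorem IsOptimal.of_contract {p : β} {T : Finset β} {ε : β → ℤ}
    (hT : (G.contract ω).IsOptimal 1 p T) (hω : IsGreatest (G.edges : Set β) ω)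
    (hl : G.tail ω ≠ G.head ω) (hε : ∀ e, e ≠ ω → ε e = 1) (hεω : ε ω = 1 ∨ ε ω = -1)
    {π₀ : V → ℤ} (h₀ : G.cob π₀ ω = 1) (h₀T : ∀ b ∈ T, G.cob π₀ b = 0)
    (hlex : LexNeg (ε ω • G.cob π₀)) : G.IsOptimal ε p (insert ω T) := by
  have hTω : ∀ b ∈ T, b ≠ ω := fun b hb => (mem_edges_contract.1 (hT.tree.subset hb)).1
  have htree := hT.tree.of_contract hω.1 hl
  refine ⟨htree, Finset.mem_insert_of_mem hT.mem, fun π hp hπ => ?_, fun x hx hx0 => ?_⟩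
  · have h1 := hT.contract_cob_sub hω.1 h₀ h₀T hp fun b hb => by
      simpa [hε b (hTω b hb)] using hπ b (Finset.mem_insert_of_mem hb)
    have h2 := smul_lexNonpos_of_sign hεω (hπ ω (Finset.mem_insert_self _ _)) hlex
    simpa using h1.add h2
  · have hne : ∀ e, e ≠ ω → (x + Pi.single ω (-x ω) : β → ℤ) e = x e := fun e he => by simp [he]
    have hx' := hx.contract hω.1
    have h1 := hT.circ_nonpos _ hx' fun e he => by
      by_cases h : e = ω
      · simp [h]
      · simpa [h, hε e h] using hx0 e (by simp [h, he])
    rcases h1 with h1 | h1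
    · refine Or.inl (htree.indep x hx fun e he => ?_)
      rw [Finset.mem_insert, not_or] at he
      rw [← hne e he.1, h1]; rfl
    · refine Or.inr (h1.of_eq_of_ne (ω := ω) (fun e he => ?_) ?_ fun e he => (hne e he).symm)
      · rw [hne e he.ne']
        exact hx.zero e fun h => absurd (hω.2 h) (not_le.2 he)
      · obtain ⟨e, he⟩ := Function.ne_iff.1 h1.ne_zero
        exact ⟨e, by rintro rfl; simp at he, he⟩

/-- Dual of `IsOptimal.of_contract`: here circulations need the correction by `x₀`, while
coboundaries change only in the last entry. -/
theorem IsOptimal.of_delete {p : β} {T : Finset β} {ε : β → ℤ}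
    (hT : (G.delete ω).IsOptimal 1 p T) (hω : IsGreatest (G.edges : Set β) ω)
    (hpω : p ≠ ω) (hε : ∀ e, e ≠ ω → ε e = 1) (hεω : ε ω = 1 ∨ ε ω = -1)
    {x₀ : β → ℤ} (hx₀ : G.IsCirculation x₀) (h₀ : x₀ ω = 1)
    (h₀T : ∀ e, e ≠ ω → e ∉ T → x₀ e = 0)
    (hlex : LexNeg (ε ω • x₀)) : G.IsOptimal ε p T := by
  have hTω : ∀ b ∈ T, b ≠ ω := fun b hb => (mem_edges_delete.1 (hT.tree.subset hb)).1
  have htree := hT.tree.of_delete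
  refine ⟨htree, hT.mem, fun π hp hπ => ?_, fun x hx hx0 => ?_⟩
  · have h1 := hT.cob_nonpos π (by rwa [cob_delete_of_ne hpω]) fun b hb => by
      rw [cob_delete_of_ne (hTω b hb)]
      simpa [hε b (hTω b hb)] using hπ b hb
    rcases h1 with h1 | h1
    · refine Or.inl (htree.cob_eq_zero fun b hb => ?_)
      rw [← cob_delete_of_ne (hTω b hb), h1]; rfl
    · refine Or.inr (h1.of_eq_of_ne (ω := ω) (fun e he => ?_) ?_
        fun e he => (cob_delete_of_ne he π).symm)
      · rw [cob_delete_of_ne he.ne']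
        exact cob_of_notMem (fun h => absurd (hω.2 h) (not_le.2 he)) _
      · obtain ⟨e, he⟩ := Function.ne_iff.1 h1.ne_zero
        exact ⟨e, by rintro rfl; exact he (cob_delete_self π), he⟩
  · have h1 := hT.delete_circ_sub hx₀ h₀ h₀T hx fun e he heT => by
      simpa [hε e he] using hx0 e heT
    have h2 := smul_lexNonpos_of_sign hεω (hx0 ω fun h => hTω ω h rfl) hlex
    simpa using h1.add h2

/-- Were `G.cob π₀` positive, the witness that `G \ ω` is not bipolar would be a sum of two
lexicographically nonpositive vectors. Being nonnegative off the last edge, it would then be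
nonpositive everywhere, and its negative would contradict bipolarity of `G`. -/
theorem IsOptimal.lexNeg_of_not_delete {p : β} {T : Finset β} (hG : G.IsLinBipolar p)
    (hT : (G.contract ω).IsOptimal 1 p T) (hω : IsGreatest (G.edges : Set β) ω) (hpω : p ≠ ω)
    (h : ¬ (G.delete ω).IsLinBipolar p)
    {π₀ : V → ℤ} (h₀ : G.cob π₀ ω = 1) (h₀T : ∀ b ∈ T, G.cob π₀ b = 0) :
    LexNeg (G.cob π₀) := by
  have hTω : ∀ b ∈ T, b ≠ ω := fun b hb => (mem_edges_contract.1 (hT.tree.subset hb)).1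
  obtain ⟨π, hp, hπ0, hπω⟩ := exists_cob_of_not_delete hG hpω h
  refine (lexNeg_or_lexNeg_neg G.edges (fun e he => cob_of_notMem he π₀)
    fun h' => by simp [h'] at h₀).resolve_right fun hD => ?_
  have h1 := hT.contract_cob_sub hω.1 h₀ h₀T hp fun b hb => hπ0 b (hTω b hb)
  have h2 : LexNonpos (G.cob π ω • G.cob π₀) :=
    smul_lexNonpos_of_sign (s := -1) (Or.inr rfl) (by omega) (by simpa using hD)
  have h3 : LexNonpos (G.cob π) := by simpa using h1.add h2
  rcases h3 with h3 | h3
  · simp [h3] at hπω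
  · have h4 := h3.nonpos_of_nonneg_of_ne
      (fun e he => cob_of_notMem (fun h => absurd (hω.2 h) (not_le.2 he)) π) hπ0
    have h5 := hG.cocirc (-π) (fun e => by simpa [cob_neg] using h4 e) (by simp [cob_neg, hp])
    rw [cob_neg, neg_eq_zero] at h5
    exact h3.ne_zero h5

/-- Dual argument, ending in a contradiction with acyclicity. -/
theorem IsOptimal.lexNeg_of_not_contract {p : β} {T : Finset β} (hG : G.IsLinBipolar p)
    (hT : (G.delete ω).IsOptimal 1 p T) (hω : IsGreatest (G.edges : Set β) ω) (hpω : p ≠ ω)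
    (h : ¬ (G.contract ω).IsLinBipolar p)
    {x₀ : β → ℤ} (hx₀ : G.IsCirculation x₀) (h₀ : x₀ ω = 1)
    (h₀T : ∀ e, e ≠ ω → e ∉ T → x₀ e = 0) : LexNeg x₀ := by
  obtain ⟨x, hx, hx0, hxω⟩ := exists_circulation_of_not_contract hG hω.1 hpω h
  refine (lexNeg_or_lexNeg_neg G.edges hx₀.zero
    fun h' => by simp [h'] at h₀).resolve_right fun hD => ?_
  have h1 := hT.delete_circ_sub hx₀ h₀ h₀T hx fun e he _ => hx0 e he
  have h2 : LexNonpos (x ω • x₀) :=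
    smul_lexNonpos_of_sign (s := -1) (Or.inr rfl) (by omega) (by simpa using hD)
  have h3 : LexNonpos x := by simpa using h1.add h2
  rcases h3 with h3 | h3
  · simp [h3] at hxω
  · have h4 := h3.nonpos_of_nonneg_of_ne
      (fun e he => hx.zero e fun h => absurd (hω.2 h) (not_le.2 he)) hx0
    have h5 := hG.circ (-x) hx.neg fun e => by simpa using h4 e
    exact h3.ne_zero (neg_eq_zero.1 h5)

/-- When both minors have an optimal tree, exactly one of the two trees extends. -/
theorem IsOptimal.lexNeg_iff {p : β} {T' T'' : Finset β}
    (h' : (G.delete ω).IsOptimal 1 p T') (h'' : (G.contract ω).IsOptimal 1 p T'')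
    (hω : IsGreatest (G.edges : Set β) ω) (hpω : p ≠ ω) (hl : G.tail ω ≠ G.head ω)
    {x₀ : β → ℤ} (hx₀ : G.IsCirculation x₀) (hx₀ω : x₀ ω = 1)
    (hx₀T : ∀ e, e ≠ ω → e ∉ T' → x₀ e = 0)
    {π₀ : V → ℤ} (hπ₀ω : G.cob π₀ ω = 1) (hπ₀T : ∀ b ∈ T'', G.cob π₀ b = 0) :
    LexNeg x₀ ↔ LexNeg (-G.cob π₀) := by
  -- After reorienting `ω` by `s`, both `T'` and `insert ω T''` would be optimal, but only the
  -- second contains `ω`. The case `s = 1` excludes that both vectors are negative, `s = -1` that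
  -- both are positive.
  have key : ∀ s : ℤ, s = 1 ∨ s = -1 → LexNeg (s • x₀) → LexNeg (s • G.cob π₀) → False := by
    intro s hs h1 h2
    set ε : β → ℤ := Function.update 1 ω s with hε
    have hεω : ε ω = s := by simp [ε]
    have hε1 : ∀ e, e ≠ ω → ε e = 1 := fun e he => by simp [ε, he]
    have o1 := h'.of_delete (ε := ε) hω hpω hε1 (by rwa [hεω]) hx₀ hx₀ω hx₀T (by rwa [hεω])
    have o2 := h''.of_contract (ε := ε) hω hl hε1 (by rwa [hεω]) hπ₀ω hπ₀T (by rwa [hεω])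
    have h3 := IsOptimal.unique (fun e => by
      by_cases he : e = ω
      · rwa [he, hεω]
      · exact Or.inl (hε1 e he)) o1 o2
    have h4 : ω ∈ T' := h3 ▸ Finset.mem_insert_self _ _
    exact (mem_edges_delete.1 (h'.tree.subset h4)).1 rfl
  constructor
  · intro h
    exact (lexNeg_or_lexNeg_neg G.edges (fun e he => cob_of_notMem he π₀)
      fun h' => by simp [h'] at hπ₀ω).resolve_left fun h2 =>
        key 1 (Or.inl rfl) (by simpa using h) (by simpa using h2)
  · intro h
    exact (lexNeg_or_lexNeg_neg G.edges hx₀.zero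
      fun h' => by simp [h'] at hx₀ω).resolve_right fun h2 =>
        key (-1) (Or.inr rfl) (by simpa using h2) (by simpa using h)

theorem isLeast_edges_contract {p : β} (hp : IsLeast (G.edges : Set β) p) (hpω : p ≠ ω) :
    IsLeast ((G.contract ω).edges : Set β) p :=
  ⟨mem_edges_contract.2 ⟨hpω, hp.1⟩, fun _ he => hp.2 (mem_edges_contract.1 he).2⟩

theorem isLeast_edges_delete {p : β} (hp : IsLeast (G.edges : Set β) p) (hpω : p ≠ ω) :
    IsLeast ((G.delete ω).edges : Set β) p :=
  ⟨mem_edges_delete.2 ⟨hpω, hp.1⟩, fun _ he => hp.2 (mem_edges_delete.1 he).2⟩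

theorem IsLinBipolar.isOptimal_singleton {p : β} (hG : G.IsLinBipolar p) (h : G.edges = {p}) :
    G.IsOptimal 1 p {p} := by
  have hE : ∀ e, e ≠ p → e ∉ G.edges := fun e he he' => he (by simpa [h] using he')
  have hcob : ∀ π, G.cob π p = 0 → G.cob π = 0 := fun π hπ => by
    ext e
    by_cases he : e = p
    · rw [he, hπ]; rfl
    · rw [cob_of_notMem (hE e he)]; rfl
  have hcirc : ∀ x, G.IsCirculation x → x = 0 := fun x hx => by
    have hx0 : ∀ e, e ≠ p → x e = 0 := fun e he => hx.zero e (hE e he)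
    rcases le_total 0 (x p) with h0 | h0
    · exact hG.circ x hx fun e => by
        by_cases he : e = p
        · rwa [he]
        · rw [hx0 e he]
    · refine neg_eq_zero.1 (hG.circ (-x) hx.neg fun e => ?_)
      by_cases he : e = p
      · simpa [he] using h0
      · simp [hx0 e he]
  exact ⟨⟨h.ge, fun π hπ => hG.const π (hcob π (hπ p (by simp))), fun x hx _ => hcirc x hx⟩,
    by simp, fun π hπ _ => Or.inl (hcob π hπ), fun x hx _ => Or.inl (hcirc x hx)⟩

end Minors

end MultiDigraph

/-! ### Sign vectors -/

namespace SignedSubset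

variable {β : Type*}

open Classical in
/-- The vector of signs of a signed subset. -/
noncomputable def vec (C : SignedSubset β) (e : β) : ℤ :=
  if e ∈ C.pos then 1 else if e ∈ C.neg then -1 else 0

variable {C : SignedSubset β} {e a : β}

theorem vec_of_mem_pos (h : e ∈ C.pos) : C.vec e = 1 := if_pos h

theorem vec_of_mem_neg (h : e ∈ C.neg) : C.vec e = -1 := by
  rw [vec, if_neg fun h' => Set.disjoint_left.1 C.disjoint h' h, if_pos h]

theorem vec_of_notMem (h : e ∉ C.support) : C.vec e = 0 := by
  rw [vec, if_neg fun h' => h (Or.inl h'), if_neg fun h' => h (Or.inr h')]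

theorem vec_neg_iff : C.vec e < 0 ↔ e ∈ C.neg := by
  refine ⟨fun h => ?_, fun h => by simp [vec_of_mem_neg h]⟩
  unfold vec at h
  split_ifs at h with h1 h2 <;> first | exact h2 | simp at h

theorem vec_pos_iff : 0 < C.vec e ↔ e ∈ C.pos := by
  refine ⟨fun h => ?_, fun h => by simp [vec_of_mem_pos h]⟩
  unfold vec at h
  split_ifs at h with h1 h2 <;> first | exact h1 | simp at h

theorem vec_ne_zero_of_mem_support (h : e ∈ C.support) : C.vec e ≠ 0 := by
  rcases h with h | h
  · simp [vec_of_mem_pos h]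
  · simp [vec_of_mem_neg h]

theorem opposite_comm : C.Opposite e a ↔ C.Opposite a e := by
  unfold Opposite; tauto

section Order

variable [LinearOrder β]

/-- The entry at `a` is the first nonzero one, and since `e` is positive, `a` is opposite to it
exactly when this entry is negative. -/
theorem opposite_iff_lexNeg (ha : IsLeast C.support a) (he : e ∈ C.pos) :
    C.Opposite a e ↔ LexNeg C.vec := by
  have he' : e ∉ C.neg := Set.disjoint_left.1 C.disjoint he
  constructor
  · intro h
    refine ⟨a, vec_neg_iff.2 (by unfold Opposite at h; tauto), fun i hi => ?_⟩
    exact vec_of_notMem fun h' => absurd (ha.2 h') (not_le.2 hi)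
  · rintro ⟨m, hm, hm'⟩
    have hma : m = a := le_antisymm
      (le_of_not_gt fun h => vec_ne_zero_of_mem_support ha.1 (hm' a h))
      (ha.2 (Or.inr (vec_neg_iff.1 hm)))
    subst hma
    exact Or.inr ⟨vec_neg_iff.1 hm, he⟩

theorem same_iff_lexNeg_neg (ha : IsLeast C.support a) (he : e ∈ C.pos) :
    C.Same a e ↔ LexNeg (-C.vec) := by
  have he' : e ∉ C.neg := Set.disjoint_left.1 C.disjoint he
  constructor
  · intro h
    refine ⟨a, ?_, fun i hi => ?_⟩
    · have := vec_pos_iff.2 (show a ∈ C.pos by unfold Same at h; tauto)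
      simpa using this
    · simp [vec_of_notMem fun h' => absurd (ha.2 h') (not_le.2 hi)]
  · rintro ⟨m, hm, hm'⟩
    have hm : m ∈ C.pos := vec_pos_iff.1 (by simpa using hm)
    have hma : m = a := le_antisymm
      (le_of_not_gt fun h => vec_ne_zero_of_mem_support ha.1 (by simpa using hm' a h))
      (ha.2 (Or.inl hm))
    subst hma
    exact Or.inl ⟨hm, he⟩

theorem exists_isLeast (E : Finset β) (hE : C.support ⊆ E) (he : e ∈ C.support) :
    ∃ a, IsLeast C.support a := by
  classical
  have hne : (E.filter fun e => e ∈ C.support).Nonempty :=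
    ⟨e, Finset.mem_filter.2 ⟨hE he, he⟩⟩
  exact ⟨_, (Finset.mem_filter.1 (Finset.min'_mem _ hne)).2, fun i hi =>
    Finset.min'_le _ i (Finset.mem_filter.2 ⟨hE hi, hi⟩)⟩

theorem exists_opposite_iff_lexNeg (E : Finset β) (hE : C.support ⊆ E) (he : e ∈ C.pos) :
    (∃ a, IsLeast C.support a ∧ C.Opposite e a) ↔ LexNeg C.vec := by
  constructor
  · rintro ⟨a, ha, h⟩
    exact (opposite_iff_lexNeg ha he).1 (opposite_comm.1 h)
  · intro h
    obtain ⟨a, ha⟩ := exists_isLeast E hE (Or.inl he)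
    exact ⟨a, ha, opposite_comm.1 ((opposite_iff_lexNeg ha he).2 h)⟩

end Order

end SignedSubset

namespace MultiDigraph

variable {V β : Type*} {G : MultiDigraph V β}

/-! ### Signed cycles and circulations -/

/-- Following successor edges, which are run according to `σ`, leads to a cycle. -/
theorem exists_isCycleRun [Finite V] (S : Set β) (hS : S ⊆ G.edges) (σ : β → Bool)
    (hne : S.Nonempty) (hs : ∀ e ∈ S, ∃ f ∈ S, G.src (f, σ f) = G.tgt (e, σ e)) :
    ∃ l, G.IsCycleRun l ∧ ∀ d ∈ l, d.1 ∈ S ∧ d.2 = σ d.1 := by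
  classical
  choose! next hnextS hnext using hs
  obtain ⟨e₀, he₀⟩ := hne
  have hmem : ∀ n, next^[n] e₀ ∈ S := fun n => by
    induction n with
    | zero => exact he₀
    | succ n ih => rw [Function.iterate_succ_apply']; exact hnextS _ ih
  let a : ℕ → β × Bool := fun n => (next^[n] e₀, σ (next^[n] e₀))
  have ha : ∀ n, G.tgt (a n) = G.src (a (n + 1)) := fun n => by
    simp only [a, Function.iterate_succ_apply']
    exact (hnext _ (hmem n)).symm
  -- The least such `j` is the first return to a visited vertex, so the vertices from `i` up to
  -- before `j` are distinct and bound a cycle.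
  have hP : ∃ j, ∃ i < j, G.src (a i) = G.src (a j) := by
    obtain ⟨i, j, hij, h⟩ := Finite.exists_ne_map_eq_of_infinite fun n => G.src (a n)
    rcases lt_or_gt_of_ne hij with h' | h'
    · exact ⟨j, i, h', h⟩
    · exact ⟨i, j, h', h.symm⟩
  obtain ⟨i, hi, hij⟩ := Nat.find_spec hP
  have hmin := fun m => Nat.find_min hP (m := m)
  generalize Nat.find hP = j at hi hij hmin
  obtain ⟨k, rfl⟩ : ∃ k, j = i + k + 1 := ⟨j - i - 1, by omega⟩
  have hinj : ∀ m n, m < i + k + 1 → n < i + k + 1 → G.src (a m) = G.src (a n) → m = n := by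
    intro m n hm hn h
    rcases lt_trichotomy m n with h' | h' | h'
    · exact absurd ⟨m, h', h⟩ (hmin _ hn)
    · exact h'
    · exact absurd ⟨n, h', h.symm⟩ (hmin _ hm)
  have hmeml : ∀ d ∈ (List.range (k + 1)).map (fun n => a (i + n)),
      ∃ n < k + 1, a (i + n) = d := by simp
  refine ⟨(List.range (k + 1)).map (fun n => a (i + n)), ⟨by simp, fun d hd => ?_, ?_, ?_, ?_, ?_⟩,
    fun d hd => ?_⟩
  · obtain ⟨n, -, rfl⟩ := hmeml d hd
    exact hS (hmem _)
  · rw [List.isChain_map]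
    rw [List.isChain_iff_getElem]
    intro n hn
    simp only [List.getElem_range]
    rw [ha]; rfl
  · rw [List.getLast?_map, List.head?_map, List.getLast?_range]
    simp [List.head?_range, ha, hij, add_assoc]
  · rw [List.map_map]
    refine List.Nodup.map_on ?_ List.nodup_range
    intro m hm n hn h
    rw [List.mem_range] at hm hn
    have := hinj (i + m) (i + n) (by omega) (by omega) h
    omega
  · rw [List.map_map]
    refine List.Nodup.map_on ?_ List.nodup_range
    intro m hm n hn h
    rw [List.mem_range] at hm hn
    have h1 : a (i + m) = a (i + n) := by
      simp only [Function.comp_apply, a] at h ⊢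
      rw [h]
    have := hinj (i + m) (i + n) (by omega) (by omega) (by rw [h1])
    omega
  · obtain ⟨n, -, rfl⟩ := hmeml d hd
    exact ⟨hmem _, rfl⟩

/-- A nonzero circulation dominates a signed cycle. -/
theorem IsCirculation.exists_isSignedCycle [Finite V] {x : β → ℤ} (hx : G.IsCirculation x)
    (hx0 : x ≠ 0) : ∃ C, G.IsSignedCycle C ∧ (∀ e ∈ C.pos, 0 < x e) ∧ ∀ e ∈ C.neg, x e < 0 := by
  classical
  obtain ⟨e₀, he₀⟩ := Function.ne_iff.1 hx0
  have hE : ∀ e, x e ≠ 0 → e ∈ G.edges := fun e h => by_contra fun h' => h (hx.zero e h')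
  obtain ⟨l, hl, hl'⟩ := exists_isCycleRun (G := G) {e | x e ≠ 0} hE (fun e => decide (0 < x e))
    ⟨e₀, he₀⟩ (by
      intro e he
      set w := G.tgt (e, decide (0 < x e)) with hw
      have he' : x e ≠ 0 := he
      by_cases hloop : G.tail e = G.head e
      · exact ⟨e, he, by simp [w, src, tgt, hloop]⟩
      by_contra! hno
      -- If no edge of the support could be run out of `w`, all contributions to the balance of `x`
      -- at `w` would have one sign, hence vanish; that of `e` does not.
      have hle : ∀ f ∈ G.edges, x f * ((Pi.single w 1 : V → ℤ) (G.tail f) -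
          (Pi.single w 1 : V → ℤ) (G.head f)) ≤ 0 := by
        intro f hf
        by_cases hxf : x f = 0
        · simp [hxf]
        have h1 := hno f hxf
        rcases lt_or_gt_of_ne hxf with h2 | h2
        · have h3 : G.head f ≠ w := by simpa [src, h2.not_gt] using h1
          simp only [Pi.single_apply, h3, if_false]
          split_ifs <;> simp [h2.le]
        · have h3 : G.tail f ≠ w := by simpa [src, h2] using h1
          simp only [Pi.single_apply, h3, if_false]
          split_ifs <;> simp [h2.le]
      have h0 := (Finset.sum_eq_zero_iff_of_nonpos hle).1 (hx.pair_eq (Pi.single w 1)) e (hE e he)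
      rcases mul_eq_zero.1 h0 with h0 | h0
      · exact he' h0
      · rcases lt_or_gt_of_ne he' with h2 | h2
        · have h3 : w = G.tail e := by simp [w, tgt, h2.not_gt]
          rw [h3] at h0
          simp [Ne.symm hloop] at h0
        · have h3 : w = G.head e := by simp [w, tgt, h2]
          rw [h3] at h0
          simp [hloop] at h0)
  have hpos : ∀ e, (e, true) ∈ l → 0 < x e := fun e he => by
    simpa using (hl' _ he).2
  have hneg : ∀ e, (e, false) ∈ l → x e < 0 := fun e he => by
    have h := hl' _ he
    exact lt_of_le_of_ne (by simpa using h.2) h.1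
  exact ⟨⟨{e | (e, true) ∈ l}, {e | (e, false) ∈ l}, Set.disjoint_left.2 fun e h h' =>
    absurd (hpos e h) (hneg e h').le.not_gt⟩, ⟨l, hl, rfl, rfl⟩, hpos, hneg⟩

open Classical in
/-- The flow vector of a walk. -/
noncomputable def walkVec (l : List (β × Bool)) : β → ℤ :=
  (l.map fun d => Pi.single d.1 (if d.2 then 1 else -1)).sum

theorem walkVec_cons (d : β × Bool) (l : List (β × Bool)) (e : β) [Decidable (e = d.1)] :
    walkVec (d :: l) e = (if e = d.1 then (if d.2 then 1 else -1) else 0) + walkVec l e := by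
  simp only [walkVec, List.map_cons, List.sum_cons, Pi.add_apply, Pi.single_apply]
  congr

theorem isFlow_walkVec (l : List (β × Bool)) (hmem : ∀ d ∈ l, d.1 ∈ G.edges)
    (hl : l.IsChain fun d d' => G.tgt d = G.src d') (hne : l ≠ []) :
    G.IsFlow (walkVec l) (G.src (l.head hne)) (G.tgt (l.getLast hne)) := by
  classical
  have hsingle : ∀ d : β × Bool, d.1 ∈ G.edges →
      G.IsFlow (Pi.single d.1 (if d.2 then 1 else -1)) (G.src d) (G.tgt d) := by
    rintro ⟨e, b⟩ he
    cases b
    · have := (isFlow_single he).neg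
      rw [← Pi.single_neg] at this
      simpa [src, tgt] using this
    · simpa [src, tgt] using isFlow_single he
  induction l with
  | nil => exact absurd rfl hne
  | cons d l ih =>
    cases l with
    | nil =>
      simp only [walkVec, List.map_cons, List.map_nil, List.sum_cons, List.sum_nil, add_zero]
      rw [List.head_singleton, List.getLast_singleton]
      convert hsingle d (hmem d (by simp)) using 1
    | cons d' l =>
      rw [List.isChain_cons_cons] at hl
      have h1 := ih (fun d hd => hmem d (List.mem_cons_of_mem _ hd)) hl.2 (by simp)
      have h2 := hsingle d (hmem d (by simp))
      rw [hl.1] at h2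
      have h3 := h2.add h1
      rw [List.getLast_cons (by simp)]
      rw [List.head_cons]
      convert h3 using 1
      ext e
      rw [walkVec_cons, Pi.add_apply, Pi.single_apply]

theorem walkVec_of_nodup (l : List (β × Bool)) (hl : (l.map Prod.fst).Nodup) (e : β) :
    ((e, true) ∈ l → walkVec l e = 1) ∧ ((e, false) ∈ l → walkVec l e = -1) ∧
    (e ∉ l.map Prod.fst → walkVec l e = 0) := by
  classical
  induction l with
  | nil => simp [walkVec]
  | cons d l ih =>
    obtain ⟨f, b⟩ := d
    rw [List.map_cons, List.nodup_cons] at hl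
    obtain ⟨h1, h2, h3⟩ := ih hl.2
    have hne : ∀ b', (e, b') ∈ l → e ≠ f := by
      rintro b' h rfl
      exact hl.1 (List.mem_map.2 ⟨_, h, rfl⟩)
    rw [walkVec_cons]
    refine ⟨fun h => ?_, fun h => ?_, fun h => ?_⟩
    · rcases List.mem_cons.1 h with h | h
      · obtain ⟨rfl, rfl⟩ := Prod.mk.inj h
        simp [h3 hl.1]
      · simp [hne _ h, h1 h]
    · rcases List.mem_cons.1 h with h | h
      · obtain ⟨rfl, rfl⟩ := Prod.mk.inj h
        simp [h3 hl.1]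
      · simp [hne _ h, h2 h]
    · rw [List.map_cons, List.mem_cons, not_or] at h
      simp [h.1, h3 h.2]

theorem IsSignedCycle.isCirculation {C : SignedSubset β} (hC : G.IsSignedCycle C) :
    G.IsCirculation C.vec := by
  obtain ⟨l, hl, hp, hn⟩ := hC
  have h1 := isFlow_walkVec l hl.mem_edges hl.chain hl.ne_nil
  have h2 : G.tgt (l.getLast hl.ne_nil) = G.src (l.head hl.ne_nil) := by
    have := hl.closed
    rw [List.getLast?_eq_some_getLast hl.ne_nil, List.head?_eq_some_head hl.ne_nil] at this
    simpa using this
  rw [h2] at h1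
  convert h1.isCirculation using 1
  ext e
  obtain ⟨k1, k2, k3⟩ := walkVec_of_nodup l hl.nodup_edges e
  by_cases hp' : e ∈ C.pos
  · rw [SignedSubset.vec_of_mem_pos hp', k1 (by rwa [hp] at hp')]
  by_cases hn' : e ∈ C.neg
  · rw [SignedSubset.vec_of_mem_neg hn', k2 (by rwa [hn] at hn')]
  rw [SignedSubset.vec_of_notMem (fun h => h.elim hp' hn'), k3]
  rw [List.mem_map]
  rintro ⟨⟨f, b⟩, hf, rfl⟩
  cases b
  · exact hn' (by rw [hn]; exact hf)
  · exact hp' (by rw [hp]; exact hf)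

theorem IsSignedCycle.vec_ne_zero {C : SignedSubset β} (hC : G.IsSignedCycle C) : C.vec ≠ 0 := by
  obtain ⟨l, hl, hp, hn⟩ := hC
  obtain ⟨⟨e, b⟩, hd⟩ := List.exists_mem_of_ne_nil l hl.ne_nil
  refine fun h => SignedSubset.vec_ne_zero_of_mem_support (C := C) (e := e) ?_ (congrFun h e)
  cases b
  · exact Or.inr (by rw [hn]; exact hd)
  · exact Or.inl (by rw [hp]; exact hd)

theorem IsSignedCycle.support_subset {C : SignedSubset β} (hC : G.IsSignedCycle C) :
    C.support ⊆ G.edges := fun e he => by_contra fun h =>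
  SignedSubset.vec_ne_zero_of_mem_support he (hC.isCirculation.zero e h)

/-! ### Spanning trees -/

theorem Joined.exists_isFlow {S : Set β} (hS : S ⊆ G.edges) {u v : V} (h : G.Joined S u v) :
    ∃ x, G.IsFlow x u v ∧ ∀ e ∉ S, x e = 0 := by
  classical
  induction h with
  | rel u v h =>
    obtain ⟨e, he, rfl, rfl⟩ := h
    exact ⟨_, isFlow_single (hS he), fun f hf =>
      Pi.single_eq_of_ne (by rintro rfl; exact hf he) _⟩
  | refl u => exact ⟨0, isFlow_zero u, fun _ _ => rfl⟩
  | symm u v _ ih =>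
    obtain ⟨x, hx, hx0⟩ := ih
    exact ⟨-x, hx.neg, fun e he => by simp [hx0 e he]⟩
  | trans u v w _ _ ih ih' =>
    obtain ⟨x, hx, hx0⟩ := ih
    obtain ⟨x', hx', hx0'⟩ := ih'
    exact ⟨x + x', hx.add hx', fun e he => by simp [hx0 e he, hx0' e he]⟩

theorem Joined.potential_eq {S : Set β} (hS : S ⊆ G.edges) {u v : V} (h : G.Joined S u v)
    {π : V → ℤ} (hπ : ∀ e ∈ S, G.cob π e = 0) : π u = π v := by
  induction h with
  | rel u v h =>
    obtain ⟨e, he, rfl, rfl⟩ := h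
    have := hπ e he
    rwa [cob_of_mem (hS he), sub_eq_zero] at this
  | refl u => rfl
  | symm u v _ ih => exact ih.symm
  | trans u v w _ _ ih ih' => exact ih.trans ih'

theorem joined_congr {S : Set β} {e : β} (he : e ∈ S) (u : V) :
    G.Joined S u (G.tail e) ↔ G.Joined S u (G.head e) := by
  have h : G.Joined S (G.tail e) (G.head e) := .rel _ _ ⟨e, he, rfl, rfl⟩
  exact ⟨fun h' => h'.trans _ _ _ h, fun h' => h'.trans _ _ _ (h.symm _ _)⟩

/-- The indicator of a set of vertices. -/
noncomputable def vertexIndicator (X : Set V) : V → ℤ := X.indicator 1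

theorem vec_signedCut (X : Set V) : (G.signedCut X).vec = G.cob (vertexIndicator X) := by
  classical
  ext e
  by_cases he : e ∈ G.edges
  · rw [cob_of_mem he]
    by_cases h1 : G.tail e ∈ X <;> by_cases h2 : G.head e ∈ X <;>
      simp [SignedSubset.vec, signedCut, vertexIndicator, he, h1, h2]
  · rw [cob_of_notMem he]
    simp [SignedSubset.vec, signedCut, he]

theorem support_signedCut_subset (X : Set V) : (G.signedCut X).support ⊆ G.edges := by
  rintro e (h | h) <;> exact h.1

theorem support_fundCocycle_subset (T : Finset β) (b : β) :
    (G.fundCocycle T b).support ⊆ G.edges := support_signedCut_subset _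

/-- Connectedness corresponds to constancy of potentials through the indicator of a component, and
absence of cycles to independence because a nonzero circulation dominates a signed cycle. -/
theorem isSpanningTree_iff_isTree [Finite V] {T : Finset β} :
    G.IsSpanningTree T ↔ G.IsTree T := by
  classical
  constructor
  · refine fun h => ⟨h.subset, fun π hπ u v => (h.connected u v).potential_eq
      (Finset.coe_subset.2 h.subset) hπ, fun x hx hx0 => by_contra fun hne => ?_⟩
    obtain ⟨C, hC, hp, hn⟩ := hx.exists_isSignedCycle hne
    refine h.no_cycle C hC fun e he => by_contra fun he' => ?_
    have h0 := hx0 e he'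
    rcases he with he | he
    · exact (hp e he).ne' h0
    · exact (hn e he).ne h0
  · refine fun h => ⟨h.subset, fun u v => ?_, fun C hC hs => ?_⟩
    · have h1 := h.const (vertexIndicator {w | G.Joined T u w}) (fun e he => ?_) u v
      · by_contra hv
        have hu : G.Joined T u u := .refl u
        simp [vertexIndicator, hu, hv] at h1
      · rw [cob_of_mem (h.subset he)]
        have := joined_congr (G := G) (S := (T : Set β)) he u
        simp [vertexIndicator, Set.indicator_apply, this]
    · exact hC.vec_ne_zero (h.indep _ hC.isCirculation fun e he =>
        SignedSubset.vec_of_notMem fun h' => he (hs h'))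

theorem IsTree.fundCocycle_spec [Finite V] {T : Finset β} (hT : G.IsTree T) {b : β} (hb : b ∈ T) :
    (∃ π, (G.fundCocycle T b).vec = G.cob π) ∧ b ∈ (G.fundCocycle T b).pos ∧
      ∀ c ∈ T, c ≠ b → (G.fundCocycle T b).vec c = 0 := by
  classical
  refine ⟨⟨_, vec_signedCut _⟩, ⟨hT.subset hb, .refl _, fun h => ?_⟩, fun c hc hcb => ?_⟩
  -- If removing `b` left its ends joined, a flow between them closed up with `b` would be a nonzero
  -- circulation supported on `T`.
  · obtain ⟨x, hx, hx0⟩ := Joined.exists_isFlow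
      (fun e he => hT.subset he.1) (show G.Joined (↑T \ {b}) _ _ from h)
    have h1 := hT.indep _ (hx.add (isFlow_single (hT.subset hb)).neg).isCirculation fun e he => by
      have : e ≠ b := by rintro rfl; exact he hb
      simp [this, hx0 e fun h' => he h'.1]
    have h2 := congrFun h1 b
    simp [hx0 b fun h' => h'.2 rfl] at h2
  · rw [fundCocycle, vec_signedCut, cob_of_mem (hT.subset hc)]
    have := joined_congr (G := G) (S := (T : Set β) \ {b}) (e := c) ⟨hc, hcb⟩ (G.tail b)
    simp [vertexIndicator, Set.indicator_apply, this]

theorem IsTree.fundCycle_spec [Finite V] {T : Finset β} (hT : G.IsTree T) {e : β}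
    (he : e ∈ G.edges) (heT : e ∉ T) :
    G.IsSignedCycle (G.fundCycle T e) ∧ e ∈ (G.fundCycle T e).pos ∧
      ∀ c, c ≠ e → c ∉ T → (G.fundCycle T e).vec c = 0 := by
  classical
  have hex : ∃ C, G.IsSignedCycle C ∧ C.support ⊆ insert e (T : Set β) ∧ e ∈ C.pos := by
    obtain ⟨x, hx, hx0⟩ := ((isSpanningTree_iff_isTree.2 hT).connected
      (G.tail e) (G.head e)).exists_isFlow (Finset.coe_subset.2 hT.subset)
    have hy := ((isFlow_single he).add hx.neg).isCirculation
    set y := Pi.single e 1 + -x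
    have hye : y e = 1 := by simp [y, hx0 e heT]
    have hy0 : ∀ c, c ≠ e → c ∉ T → y c = 0 := fun c hc hcT => by simp [y, hc, hx0 c hcT]
    obtain ⟨C, hC, hp, hn⟩ := hy.exists_isSignedCycle fun h => by simp [h] at hye
    have hsup : C.support ⊆ insert e (T : Set β) := fun c hc => by
      by_contra h
      rw [Set.mem_insert_iff, not_or] at h
      have h0 := hy0 c h.1 h.2
      rcases hc with hc | hc
      · exact (hp c hc).ne' h0
      · exact (hn c hc).ne h0
    -- The cycle found must use `e`, since otherwise it would lie in `T`; it uses `e` positively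
    -- because `y e = 1`.
    refine ⟨C, hC, hsup, by_contra fun hep => hC.vec_ne_zero
      (hT.indep _ hC.isCirculation fun c hc => SignedSubset.vec_of_notMem fun h => ?_)⟩
    rcases hsup h with rfl | h'
    · rcases h with h | h
      · exact hep h
      · have := hn c h
        omega
    · exact hc h'
  rw [fundCycle, dif_pos hex]
  obtain ⟨h1, h2, h3⟩ := hex.choose_spec
  exact ⟨h1, h3, fun c hc hcT => SignedSubset.vec_of_notMem fun h =>
    (h2 h).elim hc fun h => hcT h⟩

/-! ### Bipolar digraphs -/

/-- There is an edge from `u` to `v`. -/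
def Step (G : MultiDigraph V β) (u v : V) : Prop := ∃ e ∈ G.edges, G.tail e = u ∧ G.head e = v

theorem exists_nonneg_isFlow {u v : V} (h : Relation.TransGen G.Step u v) :
    ∃ x, G.IsFlow x u v ∧ (∀ e, 0 ≤ x e) ∧ x ≠ 0 := by
  classical
  induction h with
  | single h =>
    obtain ⟨e, he, rfl, rfl⟩ := h
    refine ⟨_, isFlow_single he, fun f => ?_, fun h => by simpa using congrFun h e⟩
    rw [Pi.single_apply]; split_ifs <;> simp
  | tail _ h ih =>
    obtain ⟨e, he, rfl, rfl⟩ := h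
    obtain ⟨x, hx, hx0, hne⟩ := ih
    have h0 : ∀ f, 0 ≤ (Pi.single e 1 : β → ℤ) f := fun f => by
      rw [Pi.single_apply]; split_ifs <;> simp
    refine ⟨_, hx.add (isFlow_single he), fun f => add_nonneg (hx0 f) (h0 f), fun h => hne ?_⟩
    ext f
    have h1 := congrFun h f
    have h2 := hx0 f
    have h3 := h0 f
    simp only [Pi.add_apply, Pi.zero_apply] at h1 ⊢
    omega

theorem not_transGen_step_self (hA : ∀ x, G.IsCirculation x → (∀ e, 0 ≤ x e) → x = 0) (v : V) :
    ¬ Relation.TransGen G.Step v v := fun h => by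
  obtain ⟨x, hx, hx0, hne⟩ := exists_nonneg_isFlow h
  exact hne (hA x hx.isCirculation hx0)

theorem wellFounded_transGen_step [Finite V]
    (hA : ∀ x, G.IsCirculation x → (∀ e, 0 ≤ x e) → x = 0) :
    WellFounded (Relation.TransGen G.Step) :=
  have : Std.Irrefl (Relation.TransGen G.Step) := ⟨not_transGen_step_self hA⟩
  Finite.wellFounded_of_trans_of_irrefl _

theorem wellFounded_swap_transGen_step [Finite V]
    (hA : ∀ x, G.IsCirculation x → (∀ e, 0 ≤ x e) → x = 0) :
    WellFounded (Function.swap (Relation.TransGen G.Step)) :=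
  have : Std.Irrefl (Function.swap (Relation.TransGen G.Step)) := ⟨not_transGen_step_self hA⟩
  Finite.wellFounded_of_trans_of_irrefl _

/-- A potential with nonnegative coboundary decreases along edges. Following edges backwards ends at
the unique source and forwards at the unique sink, so its extreme values are those at the ends of
`p`; if these agree, it is constant. -/
theorem IsBipolar.isLinBipolar [Finite V] {p : β} (h : G.IsBipolar p) : G.IsLinBipolar p := by
  have hA : ∀ x, G.IsCirculation x → (∀ e, 0 ≤ x e) → x = 0 := by
    intro x hx hx0
    by_contra hne
    obtain ⟨C, hC, -, hn⟩ := hx.exists_isSignedCycle hne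
    exact h.acyclic ⟨C, hC, Set.eq_empty_of_forall_notMem fun e he =>
      absurd (hx0 e) (not_le.2 (hn e he))⟩
  have hstep : ∀ π : V → ℤ, (∀ e, 0 ≤ G.cob π e) → ∀ e ∈ G.edges,
      π (G.head e) ≤ π (G.tail e) := fun π hπ e he => by
    have := hπ e
    rwa [cob_of_mem he, sub_nonneg] at this
  have hup : ∀ π : V → ℤ, (∀ e, 0 ≤ G.cob π e) → ∀ v, π v ≤ π (G.tail p) := by
    intro π hπ v
    induction v using (wellFounded_transGen_step hA).induction with
    | _ v ih =>
      by_cases hv : G.IsSource v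
      · rw [(h.source_iff v).1 hv]
      · simp only [IsSource, not_forall, not_not] at hv
        obtain ⟨e, he, rfl⟩ := hv
        exact (hstep π hπ e he).trans (ih _ (.single ⟨e, he, rfl, rfl⟩))
  have hdown : ∀ π : V → ℤ, (∀ e, 0 ≤ G.cob π e) → ∀ v, π (G.head p) ≤ π v := by
    intro π hπ v
    induction v using (wellFounded_swap_transGen_step hA).induction with
    | _ v ih =>
      by_cases hv : G.IsSink v
      · rw [(h.sink_iff v).1 hv]
      · simp only [IsSink, not_forall, not_not] at hv
        obtain ⟨e, he, rfl⟩ := hv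
        exact (ih _ (.single ⟨e, he, rfl, rfl⟩)).trans (hstep π hπ e he)
  have hconst : ∀ π : V → ℤ, (∀ e, 0 ≤ G.cob π e) → G.cob π p = 0 → ∀ u v, π u = π v := by
    intro π hπ hp u v
    rw [cob_of_mem h.mem_edges] at hp
    have h1 := hup π hπ u
    have h2 := hup π hπ v
    have h3 := hdown π hπ u
    have h4 := hdown π hπ v
    omega
  refine ⟨h.mem_edges, hA, fun π hπ hp => ?_, fun π hπ => hconst π (by simp [hπ]) (by simp [hπ])⟩
  ext e
  by_cases he : e ∈ G.edges
  · simp [cob_of_mem he, hconst π hπ hp (G.tail e) (G.head e)]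
  · simp [cob_of_notMem he]

/-- The indicator of a source other than the tail of `p` would have nonnegative coboundary vanishing
at `p`, hence be constant. Sinks are treated with the opposite indicator. -/
theorem IsLinBipolar.isBipolar [Finite V] {p : β} (h : G.IsLinBipolar p) : G.IsBipolar p := by
  classical
  have hsource : ∀ v, G.IsSource v → v = G.tail p := by
    intro v hv
    by_contra hne
    have h1 : ∀ e, 0 ≤ G.cob (Pi.single v 1) e := fun e => by
      by_cases he : e ∈ G.edges
      · rw [cob_of_mem he, Pi.single_eq_of_ne (hv e he), sub_zero, Pi.single_apply]
        split_ifs <;> simp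
      · rw [cob_of_notMem he]
    have h2 := h.const _ (h.cocirc _ h1 (by
      rw [cob_of_mem h.mem, Pi.single_eq_of_ne (hv p h.mem), Pi.single_eq_of_ne (Ne.symm hne),
        sub_zero])) v (G.tail p)
    simp [Ne.symm hne] at h2
  have hsink : ∀ v, G.IsSink v → v = G.head p := by
    intro v hv
    by_contra hne
    have h1 : ∀ e, 0 ≤ G.cob (-Pi.single v 1) e := fun e => by
      by_cases he : e ∈ G.edges
      · rw [cob_of_mem he, Pi.neg_apply, Pi.neg_apply, Pi.single_eq_of_ne (hv e he),
          Pi.single_apply]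
        split_ifs <;> simp
      · rw [cob_of_notMem he]
    have h2 := h.const _ (h.cocirc _ h1 (by
      rw [cob_of_mem h.mem, Pi.neg_apply, Pi.neg_apply, Pi.single_eq_of_ne (hv p h.mem),
        Pi.single_eq_of_ne (Ne.symm hne), sub_self])) v (G.head p)
    simp [Ne.symm hne] at h2
  refine ⟨h.mem, ?_, fun v => ⟨hsource v, ?_⟩, fun v => ⟨hsink v, ?_⟩⟩
  · rintro ⟨C, hC, hn⟩
    refine hC.vec_ne_zero (h.circ _ hC.isCirculation fun e => ?_)
    by_contra he
    have := SignedSubset.vec_neg_iff.1 (not_le.1 he)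
    rw [hn] at this
    exact this
  -- Some source exists by finiteness and acyclicity; being the only candidate, the tail of `p` is
  -- that source.
  · obtain ⟨s, -, hs⟩ := (wellFounded_transGen_step h.circ).has_min Set.univ ⟨v, trivial⟩
    have hs' : G.IsSource s := fun e he hes => hs _ trivial (.single ⟨e, he, rfl, hes⟩)
    rintro rfl
    rwa [← hsource s hs']
  · obtain ⟨s, -, hs⟩ := (wellFounded_swap_transGen_step h.circ).has_min Set.univ ⟨v, trivial⟩
    have hs' : G.IsSink s := fun e he hes => hs _ trivial (.single ⟨e, he, hes, rfl⟩)
    rintro rfl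
    rwa [← hsink s hs']

theorem isBipolar_iff [Finite V] {p : β} : G.IsBipolar p ↔ G.IsLinBipolar p :=
  ⟨IsBipolar.isLinBipolar, IsLinBipolar.isBipolar⟩

/-! ### The full optimality criterion -/

theorem lexNeg_vec_or_neg [LinearOrder β] {C : SignedSubset β} (hC : C.support ⊆ G.edges) {e : β}
    (he : e ∈ C.pos) : LexNeg C.vec ∨ LexNeg (-C.vec) :=
  lexNeg_or_lexNeg_neg G.edges (fun _ hf => SignedSubset.vec_of_notMem fun h => hf (hC h))
    fun h => by simpa [SignedSubset.vec_of_mem_pos he] using congrFun h e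

theorem ne_of_one_lt_card [LinearOrder β] {p ω : β} (hp : IsLeast (G.edges : Set β) p)
    (hω : IsGreatest (G.edges : Set β) ω) (h : 1 < G.edges.card) : p ≠ ω := by
  rintro rfl
  refine absurd (Finset.card_le_one.2 fun a ha b hb => ?_) (not_le.2 h)
  rw [le_antisymm (hω.2 ha) (hp.2 ha), le_antisymm (hω.2 hb) (hp.2 hb)]

section FullyOptimal

variable [LinearOrder β] [Finite V]

theorem IsFullyOptimal.isOptimal {p : β} (hp : IsLeast (G.edges : Set β) p) {T : Finset β}
    (h : G.IsFullyOptimal T) : G.IsOptimal 1 p T := by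
  have hT := isSpanningTree_iff_isTree.1 h.tree
  have hcocyc : ∀ b ∈ T, b ≠ p → LexNeg (G.fundCocycle T b).vec := fun b hb hbp =>
    (SignedSubset.exists_opposite_iff_lexNeg G.edges (support_fundCocycle_subset _ _)
      (hT.fundCocycle_spec hb).2.1).1 (h.internal b hb fun h' => hbp (h'.unique hp))
  have hcyc : ∀ e ∈ G.edges, e ∉ T → LexNeg (G.fundCycle T e).vec := fun e he heT =>
    (SignedSubset.exists_opposite_iff_lexNeg G.edges
      (hT.fundCycle_spec he heT).1.support_subset (hT.fundCycle_spec he heT).2.1).1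
      (h.external e he heT)
  refine ⟨hT, by_contra fun hpT => ?_, fun π hπp hπ => ?_, fun x hx hx0 => ?_⟩
  -- Outside `T`, the edge `p` would be both positive and least in its own fundamental cycle.
  · obtain ⟨hC, hpos, -⟩ := hT.fundCycle_spec hp.1 hpT
    obtain ⟨m, hm, hm'⟩ := hcyc p hp.1 hpT
    have h1 : p ≤ m := hp.2 (hC.support_subset (Or.inr (SignedSubset.vec_neg_iff.1 hm)))
    rcases h1.eq_or_lt with rfl | h1
    · rw [SignedSubset.vec_of_mem_pos hpos] at hm
      omega
    · have := hm' p h1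
      rw [SignedSubset.vec_of_mem_pos hpos] at this
      omega
  · choose! π' hπ' using fun b hb => (hT.fundCocycle_spec (b := b) hb).1
    -- Expansion in the fundamental cocycles: the difference vanishes on `T`. The coefficients are
    -- nonnegative, and that of `p`, whose cocycle is not constrained, is zero.
    have h1 : G.cob (π - ∑ b ∈ T, G.cob π b • π' b) = 0 := by
      refine hT.cob_eq_zero fun c hc => ?_
      rw [cob_sub, cob_sum, Pi.sub_apply, Finset.sum_apply, Finset.sum_eq_single_of_mem c hc]
      · rw [cob_smul, ← hπ' c hc, Pi.smul_apply,
          SignedSubset.vec_of_mem_pos (hT.fundCocycle_spec hc).2.1]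
        simp
      · intro b hb hbc
        rw [cob_smul, ← hπ' b hb, Pi.smul_apply, (hT.fundCocycle_spec hb).2.2 c hc hbc.symm,
          smul_zero]
    rw [cob_sub, cob_sum, sub_eq_zero] at h1
    rw [h1]
    refine LexNonpos.sum _ _ fun b hb => ?_
    rw [cob_smul]
    by_cases hbp : b = p
    · rw [hbp, hπp, zero_smul]; exact Or.inl rfl
    · rw [← hπ' b hb]
      exact LexNonpos.smul (Or.inr (hcocyc b hb hbp)) (by simpa using hπ b hb)
  -- Expansion in the fundamental cycles: the difference is a circulation supported on `T`.
  · have h1 : x - ∑ e ∈ G.edges \ T, x e • (G.fundCycle T e).vec = 0 := by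
      refine hT.indep _ (hx.sub (IsCirculation.sum _ _ fun e he => ?_)) fun c hc => ?_
      · rw [Finset.mem_sdiff] at he
        exact (hT.fundCycle_spec he.1 he.2).1.isCirculation.smul _
      · have h2 : ∀ e ∈ G.edges \ T, e ≠ c → (x e • (G.fundCycle T e).vec) c = 0 := by
          intro e he hec
          rw [Finset.mem_sdiff] at he
          rw [Pi.smul_apply, (hT.fundCycle_spec he.1 he.2).2.2 c hec.symm hc, smul_zero]
        rw [Pi.sub_apply, Finset.sum_apply]
        by_cases hcE : c ∈ G.edges
        · rw [Finset.sum_eq_single_of_mem c (Finset.mem_sdiff.2 ⟨hcE, hc⟩) h2, Pi.smul_apply,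
            SignedSubset.vec_of_mem_pos (hT.fundCycle_spec hcE hc).2.1]
          simp
        · rw [Finset.sum_eq_zero fun e he => h2 e he (by
            rintro rfl; exact hcE (Finset.mem_sdiff.1 he).1), hx.zero c hcE, sub_zero]
    rw [sub_eq_zero] at h1
    rw [h1]
    refine LexNonpos.sum _ _ fun e he => ?_
    rw [Finset.mem_sdiff] at he
    exact LexNonpos.smul (Or.inr (hcyc e he.1 he.2)) (by simpa using hx0 e he.2)

/-- Fundamental cocycles of edges other than `p` and fundamental cycles are themselves among the
vectors that `IsOptimal` tests. -/
theorem IsOptimal.isFullyOptimal {p : β} (hp : IsLeast (G.edges : Set β) p) {T : Finset β}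
    (h : G.IsOptimal 1 p T) : G.IsFullyOptimal T := by
  refine ⟨isSpanningTree_iff_isTree.2 h.tree, fun b hb hbp => ?_, fun e he heT => ?_⟩
  · obtain ⟨⟨π, hπ⟩, hpos, h0⟩ := h.tree.fundCocycle_spec hb
    have hb1 := SignedSubset.vec_of_mem_pos hpos
    refine (SignedSubset.exists_opposite_iff_lexNeg G.edges (support_fundCocycle_subset _ _) hpos).2 ?_
    have hne : p ≠ b := by rintro rfl; exact hbp hp
    have h1 := h.cob_nonpos π (by rw [← hπ, h0 p h.mem hne]) fun c hc => by
      rw [← hπ]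
      by_cases hcb : c = b
      · subst hcb; simp [hb1]
      · simp [h0 c hc hcb]
    rw [← hπ] at h1
    exact h1.resolve_left fun h' => by simp [h'] at hb1
  · obtain ⟨hC, hpos, h0⟩ := h.tree.fundCycle_spec he heT
    have he1 := SignedSubset.vec_of_mem_pos hpos
    refine (SignedSubset.exists_opposite_iff_lexNeg G.edges hC.support_subset hpos).2 ?_
    have h1 := h.circ_nonpos _ hC.isCirculation fun c hc => by
      by_cases hce : c = e
      · subst hce; simp [he1]
      · simp [h0 c hce hc]
    exact h1.resolve_left fun h' => by simp [h'] at he1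

theorem IsOptimal.alpha_eq {p : β} (hp : IsLeast (G.edges : Set β) p) {T : Finset β}
    (h : G.IsOptimal 1 p T) : G.alpha = T := by
  have hex : ∃! T, G.IsFullyOptimal T := ⟨T, h.isFullyOptimal hp, fun T' hT' =>
    IsOptimal.unique (fun _ => Or.inl rfl) (hT'.isOptimal hp) h⟩
  rw [alpha, dif_pos hex]
  exact IsOptimal.unique (fun _ => Or.inl rfl) (hex.choose_spec.1.isOptimal hp) h

/-! ### Deletion and contraction of the greatest edge -/

variable {ω p : β} {T : Finset β}

theorem IsOptimal.fundCycle_of_delete (hT : (G.delete ω).IsOptimal 1 p T) (hω : ω ∈ G.edges) :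
    G.IsSignedCycle (G.fundCycle T ω) ∧ ω ∈ (G.fundCycle T ω).pos ∧
      ∀ c, c ≠ ω → c ∉ T → (G.fundCycle T ω).vec c = 0 :=
  hT.tree.of_delete.fundCycle_spec hω fun h => (mem_edges_delete.1 (hT.tree.subset h)).1 rfl

theorem IsOptimal.fundCocycle_of_contract (hT : (G.contract ω).IsOptimal 1 p T)
    (hω : ω ∈ G.edges) (hl : G.tail ω ≠ G.head ω) :
    (∃ π, (G.fundCocycle (insert ω T) ω).vec = G.cob π) ∧
      ω ∈ (G.fundCocycle (insert ω T) ω).pos ∧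
      ∀ b ∈ T, (G.fundCocycle (insert ω T) ω).vec b = 0 := by
  obtain ⟨h1, h2, h3⟩ := (hT.tree.of_contract hω hl).fundCocycle_spec (Finset.mem_insert_self _ _)
  exact ⟨h1, h2, fun b hb => h3 b (Finset.mem_insert_of_mem hb)
    (mem_edges_contract.1 (hT.tree.subset hb)).1⟩

theorem IsOptimal.of_delete_of_lexNeg (hT : (G.delete ω).IsOptimal 1 p T)
    (hω : IsGreatest (G.edges : Set β) ω) (hpω : p ≠ ω)
    (h : LexNeg (G.fundCycle T ω).vec) : G.IsOptimal 1 p T := by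
  obtain ⟨h1, h2, h3⟩ := hT.fundCycle_of_delete hω.1
  exact hT.of_delete hω hpω (fun _ _ => rfl) (Or.inl rfl) h1.isCirculation
    (SignedSubset.vec_of_mem_pos h2) h3 (by simpa using h)

theorem IsOptimal.of_contract_of_lexNeg (hT : (G.contract ω).IsOptimal 1 p T)
    (hω : IsGreatest (G.edges : Set β) ω) (hl : G.tail ω ≠ G.head ω)
    (h : LexNeg (G.fundCocycle (insert ω T) ω).vec) : G.IsOptimal 1 p (insert ω T) := by
  obtain ⟨⟨π, hπ⟩, h2, h3⟩ := hT.fundCocycle_of_contract hω.1 hl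
  have h1 := SignedSubset.vec_of_mem_pos h2
  rw [hπ] at h h1 h3
  exact hT.of_contract hω hl (fun _ _ => rfl) (Or.inl rfl) h1 h3 (by simpa using h)

theorem IsOptimal.of_not_contract (hG : G.IsLinBipolar p) (hT : (G.delete ω).IsOptimal 1 p T)
    (hω : IsGreatest (G.edges : Set β) ω) (hpω : p ≠ ω)
    (h : ¬ (G.contract ω).IsLinBipolar p) : G.IsOptimal 1 p T := by
  obtain ⟨h1, h2, h3⟩ := hT.fundCycle_of_delete hω.1
  exact hT.of_delete_of_lexNeg hω hpω (hT.lexNeg_of_not_contract hG hω hpω h h1.isCirculation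
    (SignedSubset.vec_of_mem_pos h2) h3)

theorem IsOptimal.of_not_delete (hG : G.IsLinBipolar p) (hT : (G.contract ω).IsOptimal 1 p T)
    (hω : IsGreatest (G.edges : Set β) ω) (hpω : p ≠ ω)
    (h : ¬ (G.delete ω).IsLinBipolar p) : G.IsOptimal 1 p (insert ω T) := by
  have hl := hG.tail_ne_head hω.1
  obtain ⟨⟨π, hπ⟩, h2, h3⟩ := hT.fundCocycle_of_contract hω.1 hl
  have h1 := SignedSubset.vec_of_mem_pos h2
  refine hT.of_contract_of_lexNeg hω hl ?_
  rw [hπ] at h1 h3 ⊢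
  exact hT.lexNeg_of_not_delete hG hω hpω h h1 h3

theorem IsOptimal.lexNeg_fundCycle_iff {T' T'' : Finset β}
    (h' : (G.delete ω).IsOptimal 1 p T') (h'' : (G.contract ω).IsOptimal 1 p T'')
    (hω : IsGreatest (G.edges : Set β) ω) (hpω : p ≠ ω) (hl : G.tail ω ≠ G.head ω) :
    LexNeg (G.fundCycle T' ω).vec ↔ LexNeg (-(G.fundCocycle (insert ω T'') ω).vec) := by
  obtain ⟨c1, c2, c3⟩ := h'.fundCycle_of_delete hω.1
  obtain ⟨⟨π, hπ⟩, d2, d3⟩ := h''.fundCocycle_of_contract hω.1 hl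
  have d1 := SignedSubset.vec_of_mem_pos d2
  rw [hπ] at d1 d3 ⊢
  exact h'.lexNeg_iff h'' hω hpω hl c1.isCirculation (SignedSubset.vec_of_mem_pos c2) c3 d1 d3

end FullyOptimal

-- Existence of the optimal tree and the inductive theorem

universe u

/-- Induction on the number of edges. The vertex type is quantified inside the statement because
contraction replaces it by a quotient. -/
theorem IsLinBipolar.exists_isOptimal {β : Type*} [LinearOrder β] {p : β} (n : ℕ) :
    ∀ {V : Type u} [Finite V] (G : MultiDigraph V β), G.edges.card = n + 1 →
      IsLeast (G.edges : Set β) p → G.IsLinBipolar p → ∃ T, G.IsOptimal 1 p T := by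
  induction n with
  | zero =>
    intro V _ G hn _ hG
    obtain ⟨q, hq⟩ := Finset.card_eq_one.1 hn
    have : p = q := by simpa [hq] using hG.mem
    exact ⟨{p}, hG.isOptimal_singleton (this ▸ hq)⟩
  | succ n ih =>
    intro V _ G hn hp hG
    have hne : G.edges.Nonempty := ⟨p, hG.mem⟩
    have hω : IsGreatest (G.edges : Set β) (G.edges.max' hne) := G.edges.isGreatest_max' hne
    set ω := G.edges.max' hne
    have hpω : p ≠ ω := ne_of_one_lt_card hp hω (by omega)
    have hcard : (G.edges.erase ω).card = n + 1 := by
      rw [Finset.card_erase_of_mem hω.1, hn]; rfl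
    have hl := hG.tail_ne_head hω.1
    have hdel := ih (G.delete ω) hcard (isLeast_edges_delete hp hpω)
    have hcon := ih (G.contract ω) hcard (isLeast_edges_contract hp hpω)
    by_cases h1 : (G.delete ω).IsLinBipolar p
    · obtain ⟨T', hT'⟩ := hdel h1
      by_cases h2 : (G.contract ω).IsLinBipolar p
      · obtain ⟨T'', hT''⟩ := hcon h2
        obtain ⟨-, d2, -⟩ := hT''.fundCocycle_of_contract hω.1 hl
        -- The sign of the fundamental cocycle of `ω` decides which of the two trees extends to `G`.
        rcases lexNeg_vec_or_neg (G := G) (support_fundCocycle_subset _ _) d2 with h | h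
        · exact ⟨_, hT''.of_contract_of_lexNeg hω hl h⟩
        · exact ⟨_, hT'.of_delete_of_lexNeg hω hpω ((hT'.lexNeg_fundCycle_iff hT'' hω hpω hl).2 h)⟩
      · exact ⟨_, hT'.of_not_contract hG hω hpω h2⟩
    · obtain ⟨T'', hT''⟩ := hcon ((hG.contract_or_delete hω.1 hpω).resolve_right h1)
      exact ⟨_, hT''.of_not_delete hG hω hpω h1⟩

theorem IsLinBipolar.isOptimal_alpha {V : Type u} {β : Type*} [Finite V] [LinearOrder β]
    {G : MultiDigraph V β} {p : β} (hp : IsLeast (G.edges : Set β) p) (hG : G.IsLinBipolar p) :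
    G.IsOptimal 1 p G.alpha := by
  obtain ⟨n, hn⟩ := Nat.exists_eq_succ_of_ne_zero (Finset.card_ne_zero_of_mem hG.mem)
  obtain ⟨T, hT⟩ := IsLinBipolar.exists_isOptimal n G hn hp hG
  rwa [hT.alpha_eq hp]

end MultiDigraph

theorem mainTheorem2 {V β : Type*} [Finite V] [LinearOrder β] (G : MultiDigraph V β) (p ω : β)
    (hp : IsLeast (G.edges : Set β) p) (hω : IsGreatest (G.edges : Set β) ω)
    (hG : G.IsBipolar p) :
    -- the fully optimal spanning tree is well defined
    (∃! T, G.IsFullyOptimal T) ∧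
    (G.edges.card = 1 → G.alpha = {ω}) ∧
    (1 < G.edges.card →
      -- the three cases below are exhaustive
      ((G.contract ω).IsBipolar p ∨ (G.delete ω).IsBipolar p) ∧
      ((G.contract ω).IsBipolar p → ¬ (G.delete ω).IsBipolar p →
        G.alpha = insert ω (G.contract ω).alpha) ∧
      ((G.delete ω).IsBipolar p → ¬ (G.contract ω).IsBipolar p →
        G.alpha = (G.delete ω).alpha) ∧
      ((G.delete ω).IsBipolar p → (G.contract ω).IsBipolar p →
        ∃ e f : β,
          -- `C = C(T'; ω)`, `e = min C`, `D = C*(T'' ∪ ω; ω)`, `f = min D`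
          let C := G.fundCycle (G.delete ω).alpha ω
          let D := G.fundCocycle (insert ω (G.contract ω).alpha) ω
          IsLeast C.support e ∧ IsLeast D.support f ∧
          (C.Opposite e ω → G.alpha = (G.delete ω).alpha) ∧
          (C.Same e ω → G.alpha = insert ω (G.contract ω).alpha) ∧
          (D.Opposite f ω → G.alpha = insert ω (G.contract ω).alpha) ∧
          (D.Same f ω → G.alpha = (G.delete ω).alpha) ∧
          -- the two tests are equivalent
          (C.Opposite e ω ↔ D.Same f ω))) := by
  simp only [MultiDigraph.isBipolar_iff] at hG ⊢
  have hα := hG.isOptimal_alpha hp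
  have hl := hG.tail_ne_head hω.1
  refine ⟨⟨G.alpha, hα.isFullyOptimal hp, fun T hT => ((hT.isOptimal hp).alpha_eq hp).symm⟩,
    fun hcard => ?_, fun hcard => ?_⟩
  · obtain ⟨q, hq⟩ := Finset.card_eq_one.1 hcard
    have h1 : p = q := by simpa [hq] using hG.mem
    have h2 : ω = q := by simpa [hq] using hω.1
    rw [h2, ← h1]
    exact (hG.isOptimal_singleton (h1 ▸ hq)).alpha_eq hp
  have hpω : p ≠ ω := MultiDigraph.ne_of_one_lt_card hp hω hcard
  have hdel := fun h : (G.delete ω).IsLinBipolar p =>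
    h.isOptimal_alpha (MultiDigraph.isLeast_edges_delete hp hpω)
  have hcon := fun h : (G.contract ω).IsLinBipolar p =>
    h.isOptimal_alpha (MultiDigraph.isLeast_edges_contract hp hpω)
  refine ⟨hG.contract_or_delete hω.1 hpω,
    fun h1 h2 => ((hcon h1).of_not_delete hG hω hpω h2).alpha_eq hp,
    fun h1 h2 => ((hdel h1).of_not_contract hG hω hpω h2).alpha_eq hp, fun h1 h2 => ?_⟩
  have hT' := hdel h1
  have hT'' := hcon h2
  obtain ⟨c1, c2, -⟩ := hT'.fundCycle_of_delete hω.1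
  obtain ⟨-, d2, -⟩ := hT''.fundCocycle_of_contract hω.1 hl
  have key := hT'.lexNeg_fundCycle_iff hT'' hω hpω hl
  obtain ⟨e, he⟩ := SignedSubset.exists_isLeast G.edges c1.support_subset (Or.inl c2)
  obtain ⟨f, hf⟩ := SignedSubset.exists_isLeast G.edges
    (MultiDigraph.support_fundCocycle_subset _ _) (Or.inl d2)
  refine ⟨e, f, he, hf, ?_⟩
  rw [SignedSubset.opposite_iff_lexNeg he c2, SignedSubset.same_iff_lexNeg_neg he c2,
    SignedSubset.opposite_iff_lexNeg hf d2, SignedSubset.same_iff_lexNeg_neg hf d2]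
  have hdelα := fun h => (hT'.of_delete_of_lexNeg hω hpω h).alpha_eq hp
  have hconα := fun h => (hT''.of_contract_of_lexNeg hω hl h).alpha_eq hp
  refine ⟨hdelα, fun h => hconα ?_, hconα, fun h => hdelα (key.2 h), key⟩
  -- When `e` and `ω` agree in `C`, the cocycle `D` must be negative: otherwise the equivalence of
  -- the tests would make `C` negative as well.
  refine (MultiDigraph.lexNeg_vec_or_neg (G := G) (MultiDigraph.support_fundCocycle_subset _ _)
    d2).resolve_right fun h' => (key.2 h').not_neg h
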